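/- Let $d\geq 1$ be an integer, let $R$ be a commutative artinian ring and let $\Lambda$ be an Artin $R$-algebra, that is, an $R$-algebra which is finitely generated as an $R$-module. Let $\operatorname{mod}\Lambda$ be the category of finitely generated right $\Lambda$-modules, let $I$ be an injective envelope of the direct sum of a complete set of representatives of the isomorphism classes of simple $R$-modules, and let $D=\operatorname{Hom}_R(-,I)$. Let $\underline{\operatorname{mod}}\,\Lambda$ and $\overline{\operatorname{mod}}\,\Lambda$ be the quotients of $\operatorname{mod}\Lambda$ by the ideal of morphisms which factor through a projective, respectively an injective, module. Let $\Omega$ denote the syzygy functor and $\operatorname{Tr}$ the Auslander--Bridger transpose (the cokernel of $\operatorname{Hom}_\Lambda(P_0,\Lambda)\to\operatorname{Hom}_\Lambda(P_1,\Lambda)$ for a projective presentation $P_1\to P_0\to M\to 0$), both regarded as functors on stable categories of right or of left modules, and put $\operatorname{Tr}_d=\operatorname{Tr}\Omega^{d-1}$, $$\tau_d=D\operatorname{Tr}_d\colon\underline{\operatorname{mod}}\,\Lambda\to\overline{\operatorname{mod}}\,\Lambda,\qquad \tau_d^-=\operatorname{Tr}_dD\colon\overline{\operatorname{mod}}\,\Lambda\to\underline{\operatorname{mod}}\,\Lambda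 .$$ Let $\mathcal M$ be a $d$-cluster-tilting subcategory of $\operatorname{mod}\Lambda$, that is, a functorially finite full subcategory with $$\mathcal M=\{X\mid \operatorname{Ext}^k_\Lambda(X,\mathcal M)=0\text{ for }1\leq k\leq d-1\}=\{Y\mid \operatorname{Ext}^k_\Lambda(\mathcal M,Y)=0\text{ for }1\leq k\leq d-1\},$$ and let $\underline{\mathcal M}\subseteq\underline{\operatorname{mod}}\,\Lambda$ and $\overline{\mathcal M}\subseteq\overline{\operatorname{mod}}\,\Lambda$ be the full subcategories on the objects of $\mathcal M$. Then $\tau_dM\in\mathcal M$ and $\tau_d^-M\in\mathcal M$ for all $M\in\mathcal M$, and the restricted functors $$\tau_d\colon\underline{\mathcal M}\to\overline{\mathcal M}\qquad\text{and}\qquad\tau_d^-\colon\overline{\mathcal M}\to\underline{\mathcal M}$$ are mutually inverse equivalences. Moreover, for all $M,N\in\mathcal M$ and all $1\leq i\leq d-1$ there is an isomorphism of $R$-modules $$\operatorname{Ext}^{d-i}_\Lambda(N,\tau_dM)\cong D\operatorname{Ext}^i_\Lambda(M,N)=0 .$$ -/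

import Mathlib

open CategoryTheory
open scoped ModuleCat.Algebra
universe u
noncomputable section
namespace HigherAR

section Syzygy

variable (A : Type u) [Ring A]

/-- Two morphisms of `mod A` are identified in the projectively stable category when their
difference factors through a finitely generated projective module. -/
def projRel : HomRel (FGModuleCat.{u} A) := fun X Y f g =>
  ∃ (P : FGModuleCat.{u} A) (_ : Module.Projective A P) (a : X ⟶ P) (b : P ⟶ Y), f - g = a ≫ b

/-- Two morphisms of `mod A` are identified in the injectively stable category when their
difference factors through a finitely generated injective module. -/
def injRel : HomRel (FGModuleCat.{u} A) := fun X Y f g =>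
  ∃ (E : FGModuleCat.{u} A) (_ : Module.Injective A E) (a : X ⟶ E) (b : E ⟶ Y), f - g = a ≫ b

/-- The projectively stable category of `mod A`. -/
abbrev PStable := CategoryTheory.Quotient (projRel A)

/-- The injectively stable category of `mod A`. -/
abbrev IStable := CategoryTheory.Quotient (injRel A)

variable {A}

lemma projRel_of_eq {X Y : FGModuleCat.{u} A} {f g : X ⟶ Y} (h : f = g) : projRel A f g :=
  ⟨FGModuleCat.of A PUnit, inferInstance, 0, 0, by simp [h]⟩

section Cover

variable (A) (M : Type u) [AddCommGroup M] [Module A M] [Module.Finite A M]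

/-- The rank of the chosen free cover of `M`. -/
def coverRank : ℕ := Classical.choose (Module.Finite.exists_fin' A M)

/-- A finitely generated free module with a surjection onto `M`. -/
abbrev Cover : Type u := Fin (coverRank A M) → A

/-- The chosen surjection from a finitely generated free module onto `M`. -/
def cover : Cover A M →ₗ[A] M :=
  Classical.choose (Classical.choose_spec (Module.Finite.exists_fin' A M))

lemma cover_surjective : Function.Surjective (cover A M) :=
  Classical.choose_spec (Classical.choose_spec (Module.Finite.exists_fin' A M))

/-- The syzygy of `M`. -/
abbrev Syz : Type u := LinearMap.ker (cover A M)

end Cover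

variable {M N K : Type u} [AddCommGroup M] [Module A M] [Module.Finite A M]
  [AddCommGroup N] [Module A N] [Module.Finite A N]
  [AddCommGroup K] [Module A K] [Module.Finite A K]

lemma exists_coverLift (f : M →ₗ[A] N) :
    ∃ h : Cover A M →ₗ[A] Cover A N, cover A N ∘ₗ h = f ∘ₗ cover A M :=
  Module.projective_lifting_property (cover A N) (f ∘ₗ cover A M) (cover_surjective A N)

/-- A lift of `f : M → N` to the chosen free covers. -/
def coverLift (f : M →ₗ[A] N) : Cover A M →ₗ[A] Cover A N :=
  Classical.choose (exists_coverLift f)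

lemma cover_coverLift (f : M →ₗ[A] N) (x : Cover A M) :
    cover A N (coverLift f x) = f (cover A M x) :=
  LinearMap.congr_fun (Classical.choose_spec (exists_coverLift f)) x

/-- The morphism between syzygies induced by the chosen lift of `f`. -/
def syzMap (f : M →ₗ[A] N) : Syz A M →ₗ[A] Syz A N :=
  (coverLift f).restrict fun x hx => by
    rw [LinearMap.mem_ker, cover_coverLift, LinearMap.mem_ker.mp hx, map_zero]

lemma syzMap_coe (f : M →ₗ[A] N) (x : Syz A M) : (syzMap f x : Cover A N) = coverLift f x := rfl

/-- If `f - f'` factors through a projective module then it factors through the free cover of the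
codomain. -/
lemma exists_factor_cover {X Y : FGModuleCat.{u} A} {f f' : X ⟶ Y} (h : projRel A f f') :
    ∃ s : X →ₗ[A] Cover A Y, ∀ x, cover A Y (s x) = f.hom.hom x - f'.hom.hom x := by
  obtain ⟨P, hP, a, b, hab⟩ := h
  obtain ⟨b', hb'⟩ := Module.projective_lifting_property (cover A Y) b.hom.hom
    (cover_surjective A Y)
  refine ⟨b' ∘ₗ a.hom.hom, fun x => ?_⟩
  have h1 := LinearMap.congr_fun hb' (a.hom.hom x)
  have h2 : (f - f').hom.hom x = (a ≫ b).hom.hom x := by rw [hab]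
  exact h1.trans h2.symm

variable [IsNoetherianRing A]

/-- The syzygy of an object of `mod A`. -/
def omegaObj (X : FGModuleCat.{u} A) : FGModuleCat.{u} A := FGModuleCat.of A (Syz A X)

/-- The morphism between syzygies given by the chosen lift. -/
def omegaMap {X Y : FGModuleCat.{u} A} (f : X ⟶ Y) : omegaObj X ⟶ omegaObj Y :=
  FGModuleCat.ofHom (syzMap f.hom.hom)

/-- Morphisms between syzygies which are induced by lifts of stably equal morphisms are stably
equal. -/
lemma omega_rel {X Y : FGModuleCat.{u} A} {f f' : X ⟶ Y} (hf : projRel A f f')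
    (h h' : Cover A X →ₗ[A] Cover A Y)
    (hh : ∀ x, cover A Y (h x) = f.hom.hom (cover A X x))
    (hh' : ∀ x, cover A Y (h' x) = f'.hom.hom (cover A X x))
    (g g' : omegaObj X ⟶ omegaObj Y)
    (hg : ∀ x : Syz A X, (g.hom.hom x : Syz A Y).1 = h x)
    (hg' : ∀ x : Syz A X, (g'.hom.hom x : Syz A Y).1 = h' x) : projRel A g g' := by
  obtain ⟨s, hs⟩ := exists_factor_cover hf
  let k : Cover A X →ₗ[A] Syz A Y := (h - h' - s ∘ₗ cover A X).codRestrict _ fun x => by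
    simp [hh, hh', hs]
  refine ⟨FGModuleCat.of A (Cover A X), inferInstanceAs (Module.Projective A (Cover A X)),
    FGModuleCat.ofHom (LinearMap.ker (cover A X)).subtype, FGModuleCat.ofHom k, ?_⟩
  ext x
  refine Subtype.ext ?_
  have hx : cover A X x.1 = 0 := x.2
  change (g.hom.hom x : Syz A Y).1 - (g'.hom.hom x : Syz A Y).1 = h x.1 - h' x.1 - s (cover A X x.1)
  have h1 := hg x
  have h2 := hg' x
  rw [hx, map_zero, sub_zero]
  exact congrArg₂ (· - ·) h1 h2

variable (A) in
/-- Heller's syzygy functor on the projectively stable category. -/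
def omega : PStable A ⥤ PStable A :=
  CategoryTheory.Quotient.lift (projRel A)
    { obj := fun X => (CategoryTheory.Quotient.functor (projRel A)).obj (omegaObj X)
      map := fun f => (CategoryTheory.Quotient.functor (projRel A)).map (omegaMap f)
      map_id := fun X => by
        rw [← CategoryTheory.Functor.map_id]
        exact CategoryTheory.Quotient.sound _ (omega_rel (projRel_of_eq rfl) (coverLift (𝟙 X : X ⟶ X).hom.hom)
          LinearMap.id (cover_coverLift _) (fun _ => rfl) _ _ (fun _ => rfl) (fun _ => rfl))
      map_comp := fun {X Y Z} f g => by
        rw [← CategoryTheory.Functor.map_comp]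
        exact CategoryTheory.Quotient.sound _ (omega_rel (projRel_of_eq rfl) (coverLift (f ≫ g).hom.hom)
          (coverLift g.hom.hom ∘ₗ coverLift f.hom.hom) (cover_coverLift _)
          (fun x => by
            change cover A Z (coverLift g.hom.hom (coverLift f.hom.hom x)) =
              g.hom.hom (f.hom.hom (cover A X x))
            rw [cover_coverLift, cover_coverLift]) _ _ (fun _ => rfl) (fun _ => rfl)) }
    fun _ _ f f' hf => CategoryTheory.Quotient.sound _ (omega_rel hf (coverLift f.hom.hom) (coverLift f'.hom.hom)
      (cover_coverLift _) (cover_coverLift _) _ _ (fun _ => rfl) (fun _ => rfl))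

variable (A) in
/-- The iterated syzygy functor `Ω ^ n`. -/
def omegaPow : ℕ → (PStable A ⥤ PStable A)
  | 0 => 𝟭 _
  | n + 1 => omegaPow n ⋙ omega A

end Syzygy

section Transpose

variable {A : Type u} [Ring A] (B : Type u) [Ring B]
  (L : Type u) [AddCommGroup L] [Module A L] [Module B L] [SMulCommClass A B L]

/-- Precomposition with `f`, as a `B`-linear map `Hom_A(N, L) → Hom_A(M, L)`. -/
def precomp {M N : Type u} [AddCommGroup M] [Module A M] [AddCommGroup N] [Module A N]
    (f : M →ₗ[A] N) : (N →ₗ[A] L) →ₗ[B] (M →ₗ[A] L) where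
  toFun φ := φ ∘ₗ f
  map_add' _ _ := rfl
  map_smul' _ _ := rfl

instance finite_homCover [Module.Finite B L] (n : ℕ) :
    Module.Finite B ((Fin n → A) →ₗ[A] L) :=
  Module.Finite.equiv ((Pi.basisFun A (Fin n)).constr B : (Fin n → L) ≃ₗ[B] _)

instance projective_homCover [Module.Projective B L] (n : ℕ) :
    Module.Projective B ((Fin n → A) →ₗ[A] L) :=
  have : Module.Projective B (Fin n → L) :=
    Module.Projective.of_equiv (DFinsupp.linearEquivFunOnFintype (R := B) (M := fun _ : Fin n => L))
  Module.Projective.of_equiv ((Pi.basisFun A (Fin n)).constr B : (Fin n → L) ≃ₗ[B] _)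

variable [IsNoetherianRing A]

variable (A) in
/-- The second cover, mapping onto the first syzygy: `P₁ → P₀ → M → 0` is exact, where
`P₀ = Cover A M` and `P₁ = Cover A (Syz A M)`. -/
def presMap (M : Type u) [AddCommGroup M] [Module A M] [Module.Finite A M] :
    Cover A (Syz A M) →ₗ[A] Cover A M :=
  (LinearMap.ker (cover A M)).subtype ∘ₗ cover A (Syz A M)

variable (A) in
/-- The transpose of `M`: the cokernel of `Hom_A(P₀, L) → Hom_A(P₁, L)`. -/
abbrev Transpose (M : Type u) [AddCommGroup M] [Module A M] [Module.Finite A M] : Type u :=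
  (Cover A (Syz A M) →ₗ[A] L) ⧸ LinearMap.range (precomp B L (presMap A M))

variable [Module.Finite B L]

/-- The transpose of an object of `mod A`. -/
def trObj (X : FGModuleCat.{u} A) : FGModuleCat.{u} B := FGModuleCat.of B (Transpose A B L X)

/-- The morphism between transposes induced by a lift `h₁ : P₁ → Q₁`. -/
def trInd {X Y : FGModuleCat.{u} A} (h₁ : Cover A (Syz A X) →ₗ[A] Cover A (Syz A Y))
    (h₀ : Cover A X →ₗ[A] Cover A Y) (hc : ∀ x, presMap A Y (h₁ x) = h₀ (presMap A X x)) :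
    trObj B L Y ⟶ trObj B L X :=
  FGModuleCat.ofHom (Submodule.mapQ _ _ (precomp B L h₁) (by
    rintro _ ⟨φ, rfl⟩
    exact ⟨φ ∘ₗ h₀, LinearMap.ext fun x => congrArg φ (hc x).symm⟩))

lemma presMap_lift {X Y : FGModuleCat.{u} A} (f : X ⟶ Y) (x : Cover A (Syz A X)) :
    presMap A Y (coverLift (syzMap f.hom.hom) x) = coverLift f.hom.hom (presMap A X x) := by
  change ((cover A (Syz A Y) (coverLift (syzMap f.hom.hom) x) : Syz A Y) : Cover A Y) = _
  rw [cover_coverLift, syzMap_coe]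
  rfl

/-- The morphism between transposes induced by the chosen lifts of `f`. -/
def trMap {X Y : FGModuleCat.{u} A} (f : X ⟶ Y) : trObj B L Y ⟶ trObj B L X :=
  trInd B L (coverLift (syzMap f.hom.hom)) (coverLift f.hom.hom) (presMap_lift f)

variable [Module.Projective B L]

/-- Morphisms between transposes which are induced by lifts of stably equal morphisms are stably
equal. -/
lemma tr_rel {X Y : FGModuleCat.{u} A} {f f' : X ⟶ Y} (hf : projRel A f f')
    (h₀ h₀' : Cover A X →ₗ[A] Cover A Y)
    (hh : ∀ x, cover A Y (h₀ x) = f.hom.hom (cover A X x))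
    (hh' : ∀ x, cover A Y (h₀' x) = f'.hom.hom (cover A X x))
    (h₁ h₁' : Cover A (Syz A X) →ₗ[A] Cover A (Syz A Y))
    (hc : ∀ x, presMap A Y (h₁ x) = h₀ (presMap A X x))
    (hc' : ∀ x, presMap A Y (h₁' x) = h₀' (presMap A X x)) :
    projRel B (trInd B L h₁ h₀ hc) (trInd B L h₁' h₀' hc') := by
  obtain ⟨s, hs⟩ := exists_factor_cover hf
  let k : Cover A X →ₗ[A] Syz A Y := (h₀ - h₀' - s ∘ₗ cover A X).codRestrict _ fun x => by
    simp [hh, hh', hs]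
  obtain ⟨t, ht⟩ := Module.projective_lifting_property (cover A (Syz A Y)) k
    (cover_surjective A (Syz A Y))
  have ht' (x : Cover A X) : presMap A Y (t x) = h₀ x - h₀' x - s (cover A X x) :=
    congrArg Subtype.val (LinearMap.congr_fun ht x)
  have hz (x : Cover A (Syz A X)) : cover A X (presMap A X x) = 0 :=
    (cover A (Syz A X) x).2
  let g : Cover A (Syz A X) →ₗ[A] Cover A (Syz A Y) := h₁ - h₁' - t ∘ₗ presMap A X
  have hg (x) : presMap A Y (g x) = 0 := by
    simp [g, hc, hc', ht', hz]
  let b : Transpose A B L Y →ₗ[B] (Cover A (Syz A X) →ₗ[A] L) :=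
    Submodule.liftQ _ (precomp B L g) (by
      rintro _ ⟨φ, rfl⟩
      refine LinearMap.ext fun x => ?_
      change φ (presMap A Y (g x)) = 0
      rw [hg, map_zero])
  refine ⟨FGModuleCat.of B (Cover A (Syz A X) →ₗ[A] L),
    inferInstanceAs (Module.Projective B (Cover A (Syz A X) →ₗ[A] L)),
    FGModuleCat.ofHom b, FGModuleCat.ofHom (Submodule.mkQ _), ?_⟩
  ext x
  obtain ⟨φ, rfl⟩ := Submodule.Quotient.mk_surjective _ x
  change Submodule.Quotient.mk (φ ∘ₗ h₁) - Submodule.Quotient.mk (φ ∘ₗ h₁') =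
    (Submodule.Quotient.mk (φ ∘ₗ g) : Transpose A B L X)
  rw [← Submodule.Quotient.mk_sub, Submodule.Quotient.eq]
  refine ⟨φ ∘ₗ t, LinearMap.ext fun x => ?_⟩
  change φ (t (presMap A X x)) = φ (h₁ x) - φ (h₁' x) - φ (h₁ x - h₁' x - t (presMap A X x))
  simp

variable (A) in
/-- The Auslander--Bridger transpose, from the stable category of `A`-modules to the opposite of
the stable category of `B`-modules, with respect to the bimodule `L`. -/
def tr : PStable A ⥤ (PStable B)ᵒᵖ :=
  CategoryTheory.Quotient.lift (projRel A)
    { obj := fun X => Opposite.op ((CategoryTheory.Quotient.functor (projRel B)).obj (trObj B L X))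
      map := fun f => ((CategoryTheory.Quotient.functor (projRel B)).map (trMap B L f)).op
      map_id := fun X => by
        rw [← op_id, ← CategoryTheory.Functor.map_id]
        congr 1
        have h : trInd B L (X := X) (Y := X) LinearMap.id LinearMap.id (fun _ => rfl) =
            𝟙 (trObj B L X) := by
          ext x
          obtain ⟨φ, rfl⟩ := Submodule.Quotient.mk_surjective _ x
          rfl
        rw [← h]
        exact CategoryTheory.Quotient.sound _ (tr_rel B L (projRel_of_eq (f := 𝟙 X) rfl) _ _ (cover_coverLift _)
          (fun _ => rfl) _ _ _ _)
      map_comp := fun {X Y Z} f g => by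
        rw [← op_comp, ← CategoryTheory.Functor.map_comp]
        congr 1
        have h : trInd B L (coverLift (syzMap g.hom.hom) ∘ₗ coverLift (syzMap f.hom.hom))
            (coverLift g.hom.hom ∘ₗ coverLift f.hom.hom)
            (fun x => by
              change presMap A Z (coverLift (syzMap g.hom.hom) (coverLift (syzMap f.hom.hom) x)) = _
              rw [presMap_lift, presMap_lift]; rfl) = trMap B L g ≫ trMap B L f := by
          ext x
          obtain ⟨φ, rfl⟩ := Submodule.Quotient.mk_surjective _ x
          rfl
        rw [← h]
        exact CategoryTheory.Quotient.sound _ (tr_rel B L (projRel_of_eq (f := f ≫ g) rfl) _ _ (cover_coverLift _)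
          (fun x => by
            change cover A Z (coverLift g.hom.hom (coverLift f.hom.hom x)) =
              g.hom.hom (f.hom.hom (cover A X x))
            rw [cover_coverLift, cover_coverLift]) _ _ _ _) }
    fun _ _ f f' hf => congrArg Quiver.Hom.op (CategoryTheory.Quotient.sound _ (tr_rel B L hf _ _
      (cover_coverLift _) (cover_coverLift _) _ _ _ _))

end Transpose
section InjectiveEnvelope

variable (R : Type u) [CommRing R]

/-- `j : N → E` is an injective envelope of the `R`-module `N`: an essential embedding into an
injective module. -/
structure IsInjectiveEnvelope {N E : Type u} [AddCommGroup N] [Module R N] [AddCommGroup E]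
    [Module R E] (j : N →ₗ[R] E) : Prop where
  injective_module : Module.Injective R E
  injective : Function.Injective j
  essential : ∀ K : Submodule R E, K ⊓ LinearMap.range j = ⊥ → K = ⊥

/-- The direct sum of a complete set of representatives `R ⧸ m` of the isomorphism classes of simple
`R`-modules. (The product is a direct sum for artinian `R`, which has finitely many maximal
ideals.) -/
abbrev SimpleSum : Type u := (m : MaximalSpectrum R) → R ⧸ m.asIdeal

/-- Injective envelopes exist. -/
lemma exists_isInjectiveEnvelope (N : Type u) [AddCommGroup N] [Module R N] :
    ∃ (E : Type u) (_ : AddCommGroup E) (_ : Module R E) (j : N →ₗ[R] E),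
      IsInjectiveEnvelope R j := by
  obtain ⟨⟨J', hJ', ι, hι⟩⟩ := EnoughInjectives.presentation (ModuleCat.of R N)
  let i : N →ₗ[R] J' := ι.hom
  have hi : Function.Injective i := (ModuleCat.mono_iff_injective ι).mp hι
  have hJ : Module.Injective R J' := Module.injective_module_of_injective_object R J'
  let P (K : Submodule R J') : Prop :=
    LinearMap.range i ≤ K ∧ ∀ L ≤ K, L ⊓ LinearMap.range i = ⊥ → L = ⊥
  obtain ⟨K, -, hK⟩ := zorn_le_nonempty₀ {K | P K} (by
    intro c hc hchain y hy
    refine ⟨sSup c, ⟨(hc hy).1.trans (le_sSup hy), fun L hL hL0 => ?_⟩, fun z hz => le_sSup hz⟩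
    rw [eq_bot_iff]
    intro x hx
    obtain ⟨K, hKc, hxK⟩ := (Submodule.mem_sSup_of_directed ⟨y, hy⟩ hchain.directedOn).mp (hL hx)
    have h0 : L ⊓ K = ⊥ := (hc hKc).2 _ inf_le_right (by
      rw [eq_bot_iff, ← hL0]
      exact inf_le_inf_right _ inf_le_left)
    rw [← h0]
    exact ⟨hx, hxK⟩) (LinearMap.range i)
    ⟨le_rfl, fun L hL hL0 => by rwa [inf_eq_left.mpr hL] at hL0⟩
  obtain ⟨C, -, hC⟩ := zorn_le_nonempty₀ {C : Submodule R J' | C ⊓ K = ⊥} (by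
    intro c hc hchain y hy
    refine ⟨sSup c, ?_, fun z hz => le_sSup hz⟩
    change sSup c ⊓ K = ⊥
    rw [eq_bot_iff]
    rintro x ⟨hx, hxK⟩
    obtain ⟨C, hCc, hxC⟩ := (Submodule.mem_sSup_of_directed ⟨y, hy⟩ hchain.directedOn).mp hx
    have h0 : C ⊓ K = ⊥ := hc hCc
    rw [← h0]
    exact ⟨hxC, hxK⟩) ⊥ (bot_inf_eq _)
  have hCK : C ⊓ K = ⊥ := hC.prop
  -- a submodule strictly larger than `C` meets `K`
  have hmeet (L : Submodule R J') (hCL : C ≤ L) (hL : L ⊓ K = ⊥) : L ≤ C := hC.le_of_ge hL hCL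
  have hinj : Function.Injective (C.mkQ ∘ₗ K.subtype) := by
    rw [injective_iff_map_eq_zero]
    intro x hx
    have h1 : (x : J') ∈ C := (Submodule.Quotient.mk_eq_zero C).mp hx
    have h2 : (x : J') ∈ C ⊓ K := ⟨h1, x.2⟩
    rw [hCK] at h2
    exact Subtype.ext h2
  obtain ⟨φ, hφ⟩ := hJ.out _ hinj K.subtype
  have hφ' (x : J') (hx : x ∈ K) : φ (C.mkQ x) = x := hφ ⟨x, hx⟩
  have hker (y : J') (hy : φ (C.mkQ y) = 0) : y ∈ C := by
    refine hmeet (LinearMap.ker (φ ∘ₗ C.mkQ)) (fun z hz => ?_) ?_ hy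
    · rw [LinearMap.mem_ker, LinearMap.comp_apply, Submodule.mkQ_apply,
        (Submodule.Quotient.mk_eq_zero C).mpr hz, map_zero]
    · rw [eq_bot_iff]
      rintro x ⟨hx, hxK⟩
      exact (hφ' x hxK).symm.trans hx
  have hrange : LinearMap.range φ = K := by
    have hle : K ≤ LinearMap.range φ := fun x hx => ⟨C.mkQ x, hφ' x hx⟩
    refine le_antisymm (hK.le_of_ge ⟨hK.prop.1.trans hle, fun L hL hL0 => ?_⟩ hle) hle
    have h1 : L ⊓ K = ⊥ := hK.prop.2 _ inf_le_right (by
      rw [eq_bot_iff, ← hL0]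
      exact inf_le_inf_right _ inf_le_left)
    have h2 : L.comap (φ ∘ₗ C.mkQ) ≤ C := by
      refine hmeet _ (fun z hz => ?_) ?_
      · rw [Submodule.mem_comap, LinearMap.comp_apply, Submodule.mkQ_apply,
          (Submodule.Quotient.mk_eq_zero C).mpr hz, map_zero]
        exact zero_mem _
      · rw [eq_bot_iff]
        rintro x ⟨hx, hxK⟩
        rw [← h1]
        exact ⟨(hφ' x hxK) ▸ hx, hxK⟩
    rw [eq_bot_iff]
    intro x hx
    obtain ⟨y, hy⟩ := hL hx
    obtain ⟨z, rfl⟩ := C.mkQ_surjective y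
    have hz : z ∈ C := h2 (by rw [Submodule.mem_comap, LinearMap.comp_apply, hy]; exact hx)
    rw [← hy, Submodule.mkQ_apply, (Submodule.Quotient.mk_eq_zero C).mpr hz, map_zero]
    exact zero_mem _
  let π : J' →ₗ[R] K := (φ ∘ₗ C.mkQ).codRestrict K fun x => hrange ▸ ⟨_, rfl⟩
  refine ⟨K, inferInstance, inferInstance, i.codRestrict K fun x => hK.prop.1 ⟨x, rfl⟩,
    ⟨⟨fun X Y _ _ _ _ f hf g => ?_⟩, fun x y hxy => hi (congrArg Subtype.val hxy), fun L hL => ?_⟩⟩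
  · obtain ⟨h, hh⟩ := hJ.out f hf (K.subtype ∘ₗ g)
    refine ⟨π ∘ₗ h, fun x => Subtype.ext ?_⟩
    change φ (C.mkQ (h (f x))) = g x
    rw [hh]
    exact hφ' _ (g x).2
  · have h1 : L.map K.subtype = ⊥ := hK.prop.2 _ (Submodule.map_subtype_le K L) (by
      rw [eq_bot_iff]
      rintro _ ⟨⟨x, hx, rfl⟩, ⟨y, hy⟩⟩
      have h2 : x ∈ L ⊓ LinearMap.range (i.codRestrict K fun x => hK.prop.1 ⟨x, rfl⟩) :=
        ⟨hx, y, Subtype.ext hy⟩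
      rw [hL] at h2
      rw [(Submodule.mem_bot R).mp h2]
      exact zero_mem _)
    rw [eq_bot_iff]
    intro x hx
    have h2 : (x : J') ∈ L.map K.subtype := ⟨x, hx, rfl⟩
    rw [h1] at h2
    exact Subtype.ext h2

variable {R} {E : Type u} [AddCommGroup E] [Module R E] {j : SimpleSum R →ₗ[R] E}

/-- An injective envelope of the sum of the simple modules cogenerates. -/
lemma IsInjectiveEnvelope.exists_ne_zero (hj : IsInjectiveEnvelope R j)
    {N : Type u} [AddCommGroup N] [Module R N] {x : N} (hx : x ≠ 0) :
    ∃ φ : N →ₗ[R] E, φ x ≠ 0 := by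
  classical
  let t : R →ₗ[R] N := LinearMap.toSpanSingleton R N x
  have hne : LinearMap.ker t ≠ ⊤ := fun h => hx <| by
    have h1 : (1 : R) ∈ LinearMap.ker t := h ▸ Submodule.mem_top
    simpa [t] using h1
  obtain ⟨m, hm, hle⟩ := Ideal.exists_le_maximal _ hne
  let a : (R ⧸ LinearMap.ker t) →ₗ[R] E :=
    j ∘ₗ LinearMap.single R (fun m : MaximalSpectrum R => R ⧸ m.asIdeal) ⟨m, hm⟩ ∘ₗ
      Submodule.factor hle
  have hi : Function.Injective ((LinearMap.ker t).liftQ t le_rfl) :=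
    LinearMap.ker_eq_bot.mp (Submodule.ker_liftQ_eq_bot' _ _ rfl)
  obtain ⟨φ, hφ⟩ := hj.injective_module.out _ hi a
  refine ⟨φ, fun h0 => ?_⟩
  have h1 := hφ (Submodule.Quotient.mk 1)
  have h2 : ((LinearMap.ker t).liftQ t le_rfl) (Submodule.Quotient.mk 1) = x :=
    one_smul R x
  rw [h2, h0] at h1
  have h3 : (LinearMap.single R (fun m : MaximalSpectrum R => R ⧸ m.asIdeal) ⟨m, hm⟩)
      (Submodule.factor hle (Submodule.Quotient.mk 1)) = 0 :=
    hj.injective (h1.symm.trans (map_zero j).symm)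
  have h4 := congrFun h3 ⟨m, hm⟩
  rw [LinearMap.single_apply, Pi.single_eq_same] at h4
  have h5 : (Ideal.Quotient.mk m 1) = 0 := h4
  rw [Ideal.Quotient.eq_zero_iff_mem] at h5
  exact hm.ne_top ((Ideal.eq_top_iff_one _).mpr h5)

/-- The dual of a simple module has length at most one. -/
lemma IsInjectiveEnvelope.length_dual_simple (hj : IsInjectiveEnvelope R j)
    (m : Ideal R) [hm : m.IsMaximal] :
    Module.length R ((R ⧸ m) →ₗ[R] E) ≤ 1 := by
  classical
  let i : (R ⧸ m) →ₗ[R] E :=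
    j ∘ₗ LinearMap.single R (fun m : MaximalSpectrum R => R ⧸ m.asIdeal) ⟨m, hm⟩
  have key (φ : (R ⧸ m) →ₗ[R] E) : φ (Submodule.Quotient.mk 1) ∈ LinearMap.range i := by
    set y := φ (Submodule.Quotient.mk 1) with hy
    by_cases hy0 : y = 0
    · rw [hy0]; exact zero_mem _
    have hmy (r : R) (hr : r ∈ m) : r • y = 0 := by
      rw [hy, ← map_smul]
      have : r • (Submodule.Quotient.mk 1 : R ⧸ m) = 0 := by
        rw [← Submodule.Quotient.mk_smul, Submodule.Quotient.mk_eq_zero]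
        simpa using hr
      rw [this, map_zero]
    have hK : (R ∙ y) ⊓ LinearMap.range j ≠ ⊥ := fun h => hy0 <| by
      have := hj.essential _ h
      simpa using this
    obtain ⟨z, hz, hz0⟩ := Submodule.exists_mem_ne_zero_of_ne_bot hK
    obtain ⟨⟨r, hr⟩, w, hw⟩ := And.imp_left Submodule.mem_span_singleton.mp hz
    have hrm : r ∉ m := fun h => hz0 (by rw [← hr]; exact hmy r h)
    obtain ⟨s, hs⟩ := hm.exists_inv hrm
    obtain ⟨c, hc, hsc⟩ := hs
    have hyz : y = s • z := by
      calc y = (s * r + c) • y := by rw [hsc, one_smul]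
        _ = s • z := by rw [add_smul, hmy c hc, add_zero, mul_smul, hr]
    have hjw : j (s • w) = y := by rw [map_smul, hw, hyz]
    refine ⟨(s • w) ⟨m, hm⟩, ?_⟩
    rw [← hjw]
    refine congrArg j ?_
    funext m'
    by_cases hmm : m' = ⟨m, hm⟩
    · subst hmm; simp
    · rw [LinearMap.single_apply, Pi.single_eq_of_ne hmm]
      have hnle : ¬ m ≤ m'.asIdeal := fun hle =>
        hmm (MaximalSpectrum.ext (hm.eq_of_le m'.isMaximal.ne_top hle).symm)
      obtain ⟨a, ham, ham'⟩ := SetLike.not_le_iff_exists.mp hnle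
      have h0 : a • (s • w) = 0 := hj.injective (by rw [map_smul, hjw, hmy a ham, map_zero])
      have h1 : a • (s • w) m' = 0 := congrFun h0 m'
      have := m'.isMaximal
      obtain ⟨b, hb⟩ := Ideal.Quotient.mk_surjective ((s • w) m')
      rw [← hb] at h1 ⊢
      have h2 : Ideal.Quotient.mk m'.asIdeal (a * b) = 0 := h1
      rw [Ideal.Quotient.eq_zero_iff_mem] at h2
      exact (Ideal.Quotient.eq_zero_iff_mem.mpr
        ((m'.isMaximal.isPrime.mem_or_mem h2).resolve_left ham')).symm
  let ev : ((R ⧸ m) →ₗ[R] E) →ₗ[R] LinearMap.range i :=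
    { toFun := fun φ => ⟨φ (Submodule.Quotient.mk 1), key φ⟩
      map_add' := fun _ _ => rfl
      map_smul' := fun _ _ => rfl }
  have hev : Function.Injective ev := fun φ ψ h => by
    have h' : φ (Submodule.Quotient.mk 1) = ψ (Submodule.Quotient.mk 1) := congrArg Subtype.val h
    refine LinearMap.ext fun x => ?_
    obtain ⟨r, rfl⟩ := Submodule.Quotient.mk_surjective _ x
    have : (Submodule.Quotient.mk r : R ⧸ m) = r • Submodule.Quotient.mk 1 := by
      rw [← Submodule.Quotient.mk_smul, smul_eq_mul, mul_one]
    rw [this, map_smul, map_smul, h']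
  have hsimple : IsSimpleModule R (R ⧸ m) := isSimpleModule_iff_isCoatom.mpr hm.out
  calc Module.length R ((R ⧸ m) →ₗ[R] E) ≤ Module.length R (LinearMap.range i) :=
        Module.length_le_of_injective ev hev
    _ ≤ Module.length R (R ⧸ m) :=
        Module.length_le_of_surjective i.rangeRestrict i.surjective_rangeRestrict
    _ = 1 := Module.length_eq_one R _

/-- Dualizing does not increase the length. -/
lemma IsInjectiveEnvelope.length_dual_le (hj : IsInjectiveEnvelope R j)
    (N : Type u) [AddCommGroup N] [Module R N] (hN : IsFiniteLength R N) :
    Module.length R (N →ₗ[R] E) ≤ Module.length R N := by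
  induction hN with
  | of_subsingleton =>
    rename_i N _ _ _
    have : Subsingleton (N →ₗ[R] E) := ⟨fun f g => LinearMap.ext fun x => by
      rw [Subsingleton.elim x 0, map_zero, map_zero]⟩
    rw [Module.length_eq_zero]
    exact zero_le
  | of_simple_quotient =>
    rename_i N _ _ S hS _ ih
    obtain ⟨m, hm, ⟨e⟩⟩ := isSimpleModule_iff_quot_maximal.mp hS
    let f : ((N ⧸ S) →ₗ[R] E) →ₗ[R] (N →ₗ[R] E) := LinearMap.lcomp R E S.mkQ
    let g : (N →ₗ[R] E) →ₗ[R] (S →ₗ[R] E) := LinearMap.lcomp R E S.subtype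
    have hf : Function.Injective f := LinearMap.lcomp_injective_of_surjective _ S.mkQ_surjective
    have hex : Function.Exact f g.rangeRestrict := by
      intro φ
      constructor
      · intro h
        have h' : φ ∘ₗ S.subtype = 0 := congrArg Subtype.val h
        have hle : S ≤ LinearMap.ker φ := fun x hx => LinearMap.congr_fun h' ⟨x, hx⟩
        exact ⟨S.liftQ φ hle, S.liftQ_mkQ φ hle⟩
      · rintro ⟨ψ, rfl⟩
        refine Subtype.ext (LinearMap.ext fun x => ?_)
        change ψ (S.mkQ x) = 0
        rw [Submodule.mkQ_apply, (Submodule.Quotient.mk_eq_zero S).mpr x.2, map_zero]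
    have h1 := Module.length_eq_add_of_exact f g.rangeRestrict hf g.surjective_rangeRestrict hex
    have h2 := Module.length_eq_add_of_exact S.subtype S.mkQ S.subtype_injective S.mkQ_surjective
      (LinearMap.exact_subtype_mkQ S)
    have h3 : Module.length R ((N ⧸ S) →ₗ[R] E) ≤ 1 := by
      rw [(LinearEquiv.congrLeft E R e).length_eq]
      exact hj.length_dual_simple m
    have h4 : Module.length R (LinearMap.range g) ≤ Module.length R S :=
      (Module.length_le_of_injective _ (LinearMap.range g).subtype_injective).trans ih
    rw [h1, h2, Module.length_eq_one R (N ⧸ S), add_comm]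
    exact add_le_add h4 h3

variable [IsArtinianRing R]

lemma isFiniteLength_of_finite (N : Type u) [AddCommGroup N] [Module R N] [Module.Finite R N] :
    IsFiniteLength R N :=
  isFiniteLength_iff_isNoetherian_isArtinian.mpr ⟨inferInstance, inferInstance⟩

lemma IsInjectiveEnvelope.finite_dual (hj : IsInjectiveEnvelope R j)
    (N : Type u) [AddCommGroup N] [Module R N] [Module.Finite R N] :
    Module.Finite R (N →ₗ[R] E) := by
  have h := hj.length_dual_le N (isFiniteLength_of_finite N)
  have h' : Module.length R (N →ₗ[R] E) ≠ ⊤ :=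
    ne_top_of_le_ne_top (Module.length_ne_top_iff.mpr (isFiniteLength_of_finite N)) h
  have := (isFiniteLength_iff_isNoetherian_isArtinian.mp (Module.length_ne_top_iff.mp h')).1
  infer_instance

/-- A finitely generated module is reflexive with respect to `Hom_R(-, E)`. -/
lemma IsInjectiveEnvelope.eval_bijective (hj : IsInjectiveEnvelope R j)
    (N : Type u) [AddCommGroup N] [Module R N] [Module.Finite R N] :
    Function.Bijective (LinearMap.applyₗ : N →ₗ[R] (N →ₗ[R] E) →ₗ[R] E) := by
  have hinj : Function.Injective (LinearMap.applyₗ : N →ₗ[R] (N →ₗ[R] E) →ₗ[R] E) := by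
    rw [injective_iff_map_eq_zero]
    intro x hx
    by_contra h0
    obtain ⟨φ, hφ⟩ := hj.exists_ne_zero h0
    exact hφ (LinearMap.congr_fun hx φ)
  refine ⟨hinj, ?_⟩
  have := hj.finite_dual N
  have := hj.finite_dual (N →ₗ[R] E)
  have hle : Module.length R ((N →ₗ[R] E) →ₗ[R] E) ≤ Module.length R N :=
    (hj.length_dual_le _ (isFiniteLength_of_finite _)).trans
      (hj.length_dual_le _ (isFiniteLength_of_finite _))
  rw [← LinearMap.range_eq_top]
  by_contra hne
  have h1 := Submodule.length_lt hne
  rw [← (LinearEquiv.ofInjective _ hinj).length_eq] at h1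
  exact absurd (h1.trans_le hle) (lt_irrefl _)

end InjectiveEnvelope
section Duality

variable {R : Type u} [CommRing R] {A B : Type u} [Ring A] [Ring B] [Algebra R A] [Algebra R B]

/-- The dual `Hom_R(M, E)` of an `A`-module `M`, regarded as a module over `B ≅ Aᵐᵒᵖ`. -/
def Dual (_e : B ≃ₐ[R] Aᵐᵒᵖ) (E : Type u) [AddCommGroup E] [Module R E]
    (M : Type u) [AddCommGroup M] [Module R M] : Type u := M →ₗ[R] E

namespace Dual

variable (e : B ≃ₐ[R] Aᵐᵒᵖ) (E : Type u) [AddCommGroup E] [Module R E]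
  (M : Type u) [AddCommGroup M] [Module R M]

instance : AddCommGroup (Dual e E M) := inferInstanceAs (AddCommGroup (M →ₗ[R] E))

instance : Module R (Dual e E M) := inferInstanceAs (Module R (M →ₗ[R] E))

instance : FunLike (Dual e E M) M E := inferInstanceAs (FunLike (M →ₗ[R] E) M E)

instance : LinearMapClass (Dual e E M) R M E :=
  inferInstanceAs (LinearMapClass (M →ₗ[R] E) R M E)

variable {E M}

lemma ext {φ ψ : Dual e E M} (h : ∀ x, φ x = ψ x) : φ = ψ := LinearMap.ext h

/-- An `R`-linear map, as an element of the dual. -/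
def ofLin (φ : M →ₗ[R] E) : Dual e E M := φ

/-- An element of the dual, as an `R`-linear map. -/
def toLin (φ : Dual e E M) : M →ₗ[R] E := φ

lemma ofLin_apply (φ : M →ₗ[R] E) (x : M) : ofLin e φ x = φ x := rfl

lemma add_apply (φ ψ : Dual e E M) (x : M) : (φ + ψ) x = φ x + ψ x := rfl

variable (E M)
variable [Module A M] [IsScalarTower R A M]

/-- `B` acts by `(b • φ) x = φ (e b • x)`. -/
instance : Module B (Dual e E M) where
  smul b φ :=
    { toFun := fun x => φ ((e b).unop • x)
      map_add' := fun x y => by rw [smul_add, map_add]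
      map_smul' := fun r x => by
        rw [RingHom.id_apply, ← map_smul, smul_algebra_smul_comm] }
  one_smul φ := LinearMap.ext fun x => by
    change φ ((e 1).unop • x) = φ x
    rw [map_one, MulOpposite.unop_one, one_smul]
  mul_smul b c φ := LinearMap.ext fun x => by
    change φ ((e (b * c)).unop • x) = φ ((e c).unop • (e b).unop • x)
    rw [map_mul, MulOpposite.unop_mul, mul_smul]
  smul_zero _ := LinearMap.ext fun _ => rfl
  smul_add _ _ _ := LinearMap.ext fun _ => rfl
  add_smul b c φ := LinearMap.ext fun x => by
    change φ ((e (b + c)).unop • x) = φ ((e b).unop • x) + φ ((e c).unop • x)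
    rw [map_add, MulOpposite.unop_add, add_smul, map_add]
  zero_smul φ := LinearMap.ext fun x => by
    change φ ((e 0).unop • x) = 0
    rw [map_zero, MulOpposite.unop_zero, zero_smul, map_zero]

variable {E M}

lemma smul_apply (b : B) (φ : Dual e E M) (x : M) : (b • φ) x = φ ((e b).unop • x) := rfl

instance : IsScalarTower R B (Dual e E M) :=
  IsScalarTower.of_algebraMap_smul fun r φ => ext e fun x => by
    rw [smul_apply, AlgEquiv.commutes, MulOpposite.algebraMap_apply, MulOpposite.unop_op,
      algebraMap_smul, map_smul]
    rfl

variable {N : Type u} [AddCommGroup N] [Module A N] [Module R N] [IsScalarTower R A N]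

variable (E) in
/-- The dual of an `A`-linear map. -/
def map (f : M →ₗ[A] N) : Dual e E N →ₗ[B] Dual e E M where
  toFun φ := ofLin e (φ.toLin ∘ₗ f.restrictScalars R)
  map_add' _ _ := rfl
  map_smul' b φ := ext e fun x =>
    congrArg (fun y => φ y) (f.map_smul (e b).unop x).symm

lemma map_apply (f : M →ₗ[A] N) (φ : Dual e E N) (x : M) : map e E f φ x = φ (f x) := rfl

variable (M) in
lemma module_finite [IsArtinianRing R] {j : SimpleSum R →ₗ[R] E} (hj : IsInjectiveEnvelope R j)
    [Module.Finite R A] [Module.Finite A M] : Module.Finite B (Dual e E M) := by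
  have : Module.Finite R M := Module.Finite.trans A M
  have : Module.Finite R (Dual e E M) := hj.finite_dual M
  exact Module.Finite.of_restrictScalars_finite R B _

variable (M) in
/-- The dual of a finitely generated projective module is injective. -/
lemma injective_of_projective (hE : Module.Injective R E) [Module.Finite A M]
    [Module.Projective A M] : Module.Injective B (Dual e E M) := by
  obtain ⟨n, q, hq⟩ := Module.Finite.exists_fin' A M
  obtain ⟨i, hi⟩ := Module.projective_lifting_property q LinearMap.id hq
  refine ⟨fun X Y _ _ _ _ f hf g => ?_⟩
  let _ : Module R X := Module.restrictScalars R B X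
  let _ : Module R Y := Module.restrictScalars R B Y
  have : IsScalarTower R B X := IsScalarTower.restrictScalars R B X
  have : IsScalarTower R B Y := IsScalarTower.restrictScalars R B Y
  have hk (k : Fin n) : ∃ h : Y →ₗ[R] E, ∀ x, h (f x) = g x (q (Pi.single k 1)) :=
    hE.out (f.restrictScalars R) hf
      { toFun := fun x => g x (q (Pi.single k 1))
        map_add' := fun x y => by rw [map_add]; rfl
        map_smul' := fun r x => by
          rw [← algebraMap_smul B r x, map_smul, algebraMap_smul]; rfl }
  choose h hh using hk
  let act (p : M) (k : Fin n) : B := e.symm (MulOpposite.op (i p k))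
  have act_add (p p' : M) (k) : act (p + p') k = act p k + act p' k := by
    simp [act]
  have act_smul (b : B) (p : M) (k) : act ((e b).unop • p) k = act p k * b := by
    simp [act]
  have act_smulR (r : R) (p : M) (k) : act (r • p) k = r • act p k := by
    have : i (r • p) = r • i p := by
      rw [← algebraMap_smul A r p, map_smul, algebraMap_smul]
    simp [act, this]
  let H (y : Y) : Dual e E M :=
    ofLin e
      { toFun := fun p => ∑ k, h k (act p k • y)
        map_add' := fun p p' => by
          simp only [act_add, add_smul, map_add, Finset.sum_add_distrib]
        map_smul' := fun r p => by
          simp only [act_smulR, smul_assoc, map_smul, Finset.smul_sum, RingHom.id_apply] }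
  have hH (y : Y) (p : M) : H y p = ∑ k, h k (act p k • y) := rfl
  refine ⟨{ toFun := H, map_add' := fun y y' => ext e fun p => ?_,
            map_smul' := fun b y => ext e fun p => ?_ }, fun x => ext e fun p => ?_⟩
  · simp only [add_apply, hH, smul_add, map_add, Finset.sum_add_distrib]
  · simp only [RingHom.id_apply, smul_apply, hH, act_smul, mul_smul]
  · change H (f x) p = g x p
    have h1 (k : Fin n) : h k (act p k • f x) = g x (q (i p k • Pi.single k 1)) := by
      rw [← map_smul, hh, map_smul, smul_apply, ← map_smul]
      simp [act]
    simp only [hH, h1]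
    rw [← map_sum, ← map_sum]
    have h2 : ∑ k, i p k • (Pi.single k 1 : Fin n → A) = i p := by
      rw [← pi_eq_sum_univ' (i p)]
    rw [h2]
    exact congrArg (g x) (LinearMap.congr_fun hi p)

variable (M) in
/-- The dual of a finitely generated injective module is projective. -/
lemma projective_of_injective [IsArtinianRing R] {j : SimpleSum R →ₗ[R] E}
    (hj : IsInjectiveEnvelope R j) [Module.Finite R A] [Module.Finite R B] [Module.Finite A M]
    [hM : Module.Injective A M] : Module.Projective B (Dual e E M) := by
  have := module_finite e M hj
  obtain ⟨n, p, hp⟩ := Module.Finite.exists_fin' B (Dual e E M)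
  let e' : A ≃ₐ[R] Bᵐᵒᵖ := (AlgEquiv.opOp R A).trans (AlgEquiv.op e.symm)
  have he' (a : A) : (e' a).unop = e.symm (MulOpposite.op a) := rfl
  let i : M →ₗ[A] Dual e' E (Fin n → B) :=
    { toFun := fun x =>
        ofLin e' { toFun := fun v => p v x
                   map_add' := fun v w => by rw [map_add]; rfl
                   map_smul' := fun r v => by
                    rw [← algebraMap_smul B r v, map_smul, algebraMap_smul]; rfl }
      map_add' := fun x y => ext e' fun v => map_add (p v) x y
      map_smul' := fun a x => ext e' fun v => by
        change p v (a • x) = p (e.symm (MulOpposite.op a) • v) x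
        rw [map_smul p, smul_apply, AlgEquiv.apply_symm_apply, MulOpposite.unop_op] }
  have i_apply (x : M) (v : Fin n → B) : i x v = p v x := rfl
  have hi : Function.Injective i := by
    rw [injective_iff_map_eq_zero]
    intro x hx
    by_contra h0
    obtain ⟨φ, hφ⟩ := hj.exists_ne_zero h0
    obtain ⟨v, hv⟩ := hp φ
    refine hφ ?_
    have h1 : i x v = 0 := by rw [hx]; rfl
    rw [i_apply, hv] at h1
    exact h1
  obtain ⟨r, hr⟩ := hM.out i hi LinearMap.id
  have hev := hj.eval_bijective (Fin n → B)
  have hs (φ : Dual e E M) : ∃ v : Fin n → B, ∀ ψ : Dual e' E (Fin n → B), ψ v = φ (r ψ) := by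
    obtain ⟨v, hv⟩ := hev.2
      { toFun := fun ψ => φ (r (ofLin e' ψ))
        map_add' := fun ψ χ =>
          (congrArg (fun y => φ y) (map_add r (ofLin e' ψ) (ofLin e' χ))).trans (map_add φ _ _)
        map_smul' := fun c ψ => by
          have h : r (c • ofLin e' ψ) = c • r (ofLin e' ψ) := by
            rw [← algebraMap_smul A c (ofLin e' ψ), map_smul, algebraMap_smul]
          exact (congrArg (fun y => φ y) h).trans (map_smul φ c _) }
    exact ⟨v, fun ψ => LinearMap.congr_fun hv ψ.toLin⟩
  choose s hs using hs
  have huniq {v w : Fin n → B} (h : ∀ ψ : Dual e' E (Fin n → B), ψ v = ψ w) : v = w :=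
    hev.1 (LinearMap.ext h)
  let S : Dual e E M →ₗ[B] (Fin n → B) :=
    { toFun := s
      map_add' := fun φ χ => huniq fun ψ => by
        rw [map_add, hs, hs, hs]; rfl
      map_smul' := fun b φ => huniq fun ψ => by
        rw [RingHom.id_apply, hs, smul_apply, ← map_smul, ← hs, smul_apply, he',
          MulOpposite.op_unop, AlgEquiv.symm_apply_apply] }
  refine Module.Projective.of_split S p (LinearMap.ext fun φ => ext e fun x => ?_)
  change p (s φ) x = φ x
  rw [← i_apply, hs, hr]
  rfl

end Dual

variable [IsArtinianRing R] (e : B ≃ₐ[R] Aᵐᵒᵖ) {E : Type u} [AddCommGroup E] [Module R E]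
  {j : SimpleSum R →ₗ[R] E} (hj : IsInjectiveEnvelope R j) [Module.Finite R A]

/-- The dual `D X = Hom_R(X, E)` of an object of `mod A`, as an object of `mod B`. -/
def dualObj (X : FGModuleCat.{u} A) : FGModuleCat.{u} B :=
  ⟨ModuleCat.of B (Dual e E X.obj), Dual.module_finite e X.obj hj⟩

/-- The dual of a morphism of `mod A`. -/
def dualMap {X Y : FGModuleCat.{u} A} (f : X ⟶ Y) : dualObj e hj Y ⟶ dualObj e hj X :=
  ObjectProperty.homMk (ModuleCat.ofHom (Dual.map e E f.hom.hom))

/-- The duality `D`, from the opposite of the projectively stable category of `mod A` to the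
injectively stable category of `mod B`. -/
def dualPI : (PStable A)ᵒᵖ ⥤ IStable B :=
  (CategoryTheory.Quotient.lift (projRel A)
    { obj := fun X => Opposite.op ((CategoryTheory.Quotient.functor (injRel B)).obj (dualObj e hj X))
      map := fun f => ((CategoryTheory.Quotient.functor (injRel B)).map (dualMap e hj f)).op
      map_id := fun _ => rfl
      map_comp := fun _ _ => rfl }
    fun X Y f g ⟨P, hP, a, b, hab⟩ => congrArg Quiver.Hom.op <| CategoryTheory.Quotient.sound _
      ⟨dualObj e hj P, Dual.injective_of_projective e P.obj hj.injective_module,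
        dualMap e hj b, dualMap e hj a, by
          ext φ
          refine Dual.ext e fun x => ?_
          have h : f.hom.hom x - g.hom.hom x = b.hom.hom (a.hom.hom x) :=
            congrArg (fun k : X ⟶ Y => k.hom.hom x) hab
          exact (map_sub (Dual.toLin e φ) _ _).symm.trans (congrArg (Dual.toLin e φ) h)⟩).leftOp

/-- The duality `D`, from the injectively stable category of `mod A` to the opposite of the
projectively stable category of `mod B`. -/
def dualIP [Module.Finite R B] : IStable A ⥤ (PStable B)ᵒᵖ :=
  CategoryTheory.Quotient.lift (injRel A)
    { obj := fun X => Opposite.op ((CategoryTheory.Quotient.functor (projRel B)).obj (dualObj e hj X))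
      map := fun f => ((CategoryTheory.Quotient.functor (projRel B)).map (dualMap e hj f)).op
      map_id := fun _ => rfl
      map_comp := fun _ _ => rfl }
    fun X Y f g ⟨P, hP, a, b, hab⟩ => congrArg Quiver.Hom.op <| CategoryTheory.Quotient.sound _
      ⟨dualObj e hj P, Dual.projective_of_injective e P.obj hj,
        dualMap e hj b, dualMap e hj a, by
          ext φ
          refine Dual.ext e fun x => ?_
          have h : f.hom.hom x - g.hom.hom x = b.hom.hom (a.hom.hom x) :=
            congrArg (fun k : X ⟶ Y => k.hom.hom x) hab
          exact (map_sub (Dual.toLin e φ) _ _).symm.trans (congrArg (Dual.toLin e φ) h)⟩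

end Duality

section Translations

/-- The right module `A` is free of rank one. -/
def opRegular (A : Type u) [Ring A] : Aᵐᵒᵖ ≃ₗ[Aᵐᵒᵖ] A where
  toFun := MulOpposite.unop
  invFun := MulOpposite.op
  map_add' _ _ := rfl
  map_smul' _ _ := rfl
  left_inv _ := rfl
  right_inv _ := rfl

instance (A : Type u) [Ring A] : Module.Finite Aᵐᵒᵖ A := Module.Finite.equiv (opRegular A)

instance (A : Type u) [Ring A] : Module.Projective Aᵐᵒᵖ A :=
  Module.Projective.of_equiv (opRegular A)

lemma isNoetherianRing_of_finite (R : Type u) [CommRing R] [IsArtinianRing R] (A : Type u) [Ring A]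
    [Algebra R A] [Module.Finite R A] : IsNoetherianRing A := IsNoetherianRing.of_finite R A

lemma finite_op (R : Type u) [CommRing R] (A : Type u) [Ring A] [Algebra R A] [Module.Finite R A] :
    Module.Finite R Aᵐᵒᵖ :=
  Module.Finite.equiv (MulOpposite.opLinearEquiv R : A ≃ₗ[R] Aᵐᵒᵖ)

variable (R : Type u) [CommRing R] [IsArtinianRing R] (A : Type u) [Ring A] [Algebra R A]
  [Module.Finite R A] {E : Type u} [AddCommGroup E] [Module R E] {j : SimpleSum R →ₗ[R] E}
  (hj : IsInjectiveEnvelope R j) (d : ℕ)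

/-- The `d`-th transpose `Tr_d = Tr Ω^{d-1}` on right modules, with values in left modules. -/
def trRight : PStable Aᵐᵒᵖ ⥤ (PStable A)ᵒᵖ :=
  haveI := finite_op R A
  haveI := isNoetherianRing_of_finite R Aᵐᵒᵖ
  omegaPow Aᵐᵒᵖ (d - 1) ⋙ tr Aᵐᵒᵖ A A

/-- The `d`-th transpose `Tr_d = Tr Ω^{d-1}` on left modules, with values in right modules. -/
def trLeft : PStable A ⥤ (PStable Aᵐᵒᵖ)ᵒᵖ :=
  haveI := isNoetherianRing_of_finite R A
  omegaPow A (d - 1) ⋙ tr A Aᵐᵒᵖ A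

/-- The `d`-Auslander--Reiten translation `τ_d = D Tr_d` on right `A`-modules. -/
def tau : PStable Aᵐᵒᵖ ⥤ IStable Aᵐᵒᵖ :=
  trRight R A d ⋙ dualPI (A := A) (B := Aᵐᵒᵖ) AlgEquiv.refl hj

/-- The inverse `d`-Auslander--Reiten translation `τ_d⁻ = Tr_d D` on right `A`-modules. -/
def tauInv : IStable Aᵐᵒᵖ ⥤ PStable Aᵐᵒᵖ :=
  haveI := finite_op R A
  dualIP (A := Aᵐᵒᵖ) (B := A) (AlgEquiv.opOp R A) hj ⋙ (trLeft R A d).leftOp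

end Translations
section ClusterTilting

variable {A : Type u} [Ring A]

/-- Every object has a right approximation by objects of `𝓜`. -/
def IsContravariantlyFinite (𝓜 : ObjectProperty (FGModuleCat.{u} A)) : Prop :=
  ∀ M, ∃ X, 𝓜 X ∧ ∃ f : X ⟶ M, ∀ X', 𝓜 X' → ∀ g : X' ⟶ M, ∃ h : X' ⟶ X, h ≫ f = g

/-- Every object has a left approximation by objects of `𝓜`. -/
def IsCovariantlyFinite (𝓜 : ObjectProperty (FGModuleCat.{u} A)) : Prop :=
  ∀ M, ∃ X, 𝓜 X ∧ ∃ f : M ⟶ X, ∀ X', 𝓜 X' → ∀ g : M ⟶ X', ∃ h : X ⟶ X', f ≫ h = g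

/-- `Ext_A^k(X, Y)` for finitely generated `A`-modules. -/
abbrev ExtFG (X Y : FGModuleCat.{u} A) (k : ℕ) : Type u := Abelian.Ext.{u} X.obj Y.obj k

/-- `d`-cluster-tilting subcategories of `mod A`. (The two equalities force such a full subcategory
to be closed under isomorphisms, finite direct sums and direct summands.) -/
structure IsClusterTilting (d : ℕ) (𝓜 : ObjectProperty (FGModuleCat.{u} A)) : Prop where
  contravariantlyFinite : IsContravariantlyFinite 𝓜
  covariantlyFinite : IsCovariantlyFinite 𝓜
  mem_iff_ext_left (X : FGModuleCat.{u} A) :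
    𝓜 X ↔ ∀ k, 1 ≤ k → k < d → ∀ M, 𝓜 M → Subsingleton (ExtFG X M k)
  mem_iff_ext_right (Y : FGModuleCat.{u} A) :
    𝓜 Y ↔ ∀ k, 1 ≤ k → k < d → ∀ M, 𝓜 M → Subsingleton (ExtFG M Y k)

/-- The objects of the projectively stable category which belong to `𝓜`. -/
def pStableProp (𝓜 : ObjectProperty (FGModuleCat.{u} A)) : ObjectProperty (PStable A) :=
  fun X => 𝓜 X.as

/-- The objects of the injectively stable category which belong to `𝓜`. -/
def iStableProp (𝓜 : ObjectProperty (FGModuleCat.{u} A)) : ObjectProperty (IStable A) :=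
  fun X => 𝓜 X.as

/-- The projectively stable category of `𝓜`. -/
abbrev PStableSub (𝓜 : ObjectProperty (FGModuleCat.{u} A)) := (pStableProp 𝓜).FullSubcategory

/-- The injectively stable category of `𝓜`. -/
abbrev IStableSub (𝓜 : ObjectProperty (FGModuleCat.{u} A)) := (iStableProp 𝓜).FullSubcategory

end ClusterTilting

section Restriction

variable (R : Type u) [CommRing R] [IsArtinianRing R] (A : Type u) [Ring A] [Algebra R A]
  [Module.Finite R A] {E : Type u} [AddCommGroup E] [Module R E] {j : SimpleSum R →ₗ[R] E}
  (hj : IsInjectiveEnvelope R j) (d : ℕ)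

/-- The module `τ_d M`. -/
def tauObj (M : FGModuleCat.{u} Aᵐᵒᵖ) : FGModuleCat.{u} Aᵐᵒᵖ :=
  ((tau R A hj d).obj ⟨M⟩).as

/-- The module `τ_d⁻ M`. -/
def tauInvObj (M : FGModuleCat.{u} Aᵐᵒᵖ) : FGModuleCat.{u} Aᵐᵒᵖ :=
  ((tauInv R A hj d).obj ⟨M⟩).as

variable (𝓜 : ObjectProperty (FGModuleCat.{u} Aᵐᵒᵖ))

/-- The restriction of `τ_d` to the stable categories of `𝓜`, when `τ_d` preserves `𝓜`. -/
def tauSub (h : ∀ M, 𝓜 M → 𝓜 (tauObj R A hj d M)) : PStableSub 𝓜 ⥤ IStableSub 𝓜 :=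
  (iStableProp 𝓜).lift ((pStableProp 𝓜).ι ⋙ tau R A hj d) fun X => h X.obj.as X.property

/-- The restriction of `τ_d⁻` to the stable categories of `𝓜`, when `τ_d⁻` preserves `𝓜`. -/
def tauInvSub (h : ∀ M, 𝓜 M → 𝓜 (tauInvObj R A hj d M)) : IStableSub 𝓜 ⥤ PStableSub 𝓜 :=
  (pStableProp 𝓜).lift ((iStableProp 𝓜).ι ⋙ tauInv R A hj d) fun X => h X.obj.as X.property

end Restriction
end HigherAR
end

open CategoryTheory
open scoped ModuleCat.Algebra

noncomputable section

/-! Everything rests on the vanishing of Ext^k for 1 ≤ k ≤ d-1, shifted along syzygies. Two facts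
about the transpose carry the equivalence.

First, Tr is stably an involution. A finitely generated free module P is reflexive, P ≅ Hom(Hom(P,
Λ), Λ), so dualizing a presentation twice recovers it up to homotopy (`etaHom_naturality`,
`isIso_stab_etaHom`). Second, if P₂ → P₁ → P₀ → X → 0 is the start of a free resolution and Ext¹(X,
Λ) = 0, then 0 → Tr X → Hom(P₂, Λ) → Tr ΩX → 0 is exact, so Tr X ≅ Ω Tr Ω X stably
(`isIso_stab_kappaHom`). Iterating, if Ext^k(X, Λ) = 0 for 1 ≤ k ≤ d-1, then Tr X ≅ Ω^{d-1} Tr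
Ω^{d-1} X, hence Tr_d Tr_d X ≅ Tr Tr X ≅ X (`isIso_trPowCounit`). Combined with D D ≅ 1, this
inverts the comparisons between τ_d⁻ τ_d, τ_d τ_d⁻ and the identity. These comparisons are natural
on the whole stable categories and become invertible where Ext vanishes.

The same exact sequence shows that τ_d preserves 𝓜 (`extVanishing_trObj`). For free P, a map Hom(P,
Λ) → DN is a linear form on Hom(P, N). With Z a syzygy of X, extending a map Tr Z → DN to Hom(P₂, Λ)
therefore means factoring a form on Hom(P₁, N) through Hom(P₁, N) → Hom(P₂, N), which Ext¹(Z, N) = 0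
and injectivity of E make possible. Dimension shifting then gives Ext^k(Tr_d X, DN) = 0, and
applying D gives Ext^k(N, τ_d X) = 0 for all N in 𝓜, which is the criterion for membership. The case
of τ_d⁻ is the same statement for DX and DN.

Cluster tilting enters through its two vanishing criteria: they put the projective Λ and the
injective DΛ into 𝓜, so Ext^k(X, Λ) = 0 and Ext^k(DX, Λ) ≅ Ext^k(DΛ, X) = 0 in the required range.
In the final formula both sides are zero. -/

namespace HigherAR

/-! ### Vanishing of Ext in a range of degrees, and dimension shifting -/

section ExtVanishing

open Abelian

variable {A : Type u} [Ring A] {K P X Y : Type u} [AddCommGroup K] [Module A K]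
  [AddCommGroup P] [Module A P] [AddCommGroup X] [Module A X] [AddCommGroup Y] [Module A Y]

variable (A X Y) in
/-- The groups `Ext^k(X, Y)` vanish for `1 ≤ k ≤ n`. -/
def ExtVanishing (n : ℕ) : Prop :=
  ∀ k, 1 ≤ k → k ≤ n → Subsingleton (Ext.{u} (ModuleCat.of A X) (ModuleCat.of A Y) k)

lemma ExtVanishing.mono {m n : ℕ} (h : ExtVanishing A X Y n) (hmn : m ≤ n) :
    ExtVanishing A X Y m := fun k h1 hk => h k h1 (hk.trans hmn)

lemma extVanishing_zero : ExtVanishing A X Y 0 := fun k h1 hk => by omega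

lemma extVanishing_of_projective [Module.Projective A X] (n : ℕ) : ExtVanishing A X Y n :=
  fun k h1 _ => by
    obtain ⟨m, rfl⟩ := Nat.exists_eq_add_of_le' h1
    exact ⟨fun a b => (Ext.eq_zero_of_projective a).trans (Ext.eq_zero_of_projective b).symm⟩

lemma extVanishing_of_injective [Module.Injective A Y] (n : ℕ) : ExtVanishing A X Y n :=
  fun k h1 _ => by
    obtain ⟨m, rfl⟩ := Nat.exists_eq_add_of_le' h1
    have : Injective (ModuleCat.of A Y) := Module.injective_object_of_injective_module A Y
    exact ⟨fun a b => (Ext.eq_zero_of_injective a).trans (Ext.eq_zero_of_injective b).symm⟩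

lemma shortExact_of {i : K →ₗ[A] P} {p : P →ₗ[A] X} (hi : Function.Injective i)
    (hp : Function.Surjective p) (hex : Function.Exact i p) :
    (ShortComplex.mk (ModuleCat.ofHom i) (ModuleCat.ofHom p)
      (by ext x; exact hex.apply_apply_eq_zero x)).ShortExact where
  exact := (ShortComplex.ShortExact.moduleCat_exact_iff_function_exact _).mpr hex
  mono_f := (ModuleCat.mono_iff_injective _).mpr hi
  epi_g := (ModuleCat.epi_iff_surjective _).mpr hp

/-- Dimension shifting in the first variable. -/
lemma extVanishing_succ_iff_left {i : K →ₗ[A] P} {p : P →ₗ[A] X} (hi : Function.Injective i)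
    (hp : Function.Surjective p) (hex : Function.Exact i p) [Module.Projective A P] (n : ℕ) :
    ExtVanishing A X Y (n + 1) ↔
      (∀ g : K →ₗ[A] Y, ∃ h : P →ₗ[A] Y, h ∘ₗ i = g) ∧ ExtVanishing A K Y n := by
  have hS := shortExact_of hi hp hex
  have hz (k : ℕ) (h1 : 1 ≤ k) (e : Ext.{u} (ModuleCat.of A P) (ModuleCat.of A Y) k) : e = 0 := by
    obtain ⟨m, rfl⟩ := Nat.exists_eq_add_of_le' h1
    exact Ext.eq_zero_of_projective e
  constructor
  · intro h
    refine ⟨fun g => ?_, fun k h1 hk => subsingleton_of_forall_eq 0 fun e => ?_⟩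
    · have := h 1 le_rfl (by omega)
      -- The obstruction to extending `g` along `i` is its image in Ext¹(X, Y) under the connecting
      -- map, and that group is zero.
      obtain ⟨e, he⟩ := Ext.contravariant_sequence_exact₁ hS _ (Ext.mk₀ (ModuleCat.ofHom g))
        (n₁ := 1) rfl (Subsingleton.elim _ _)
      obtain ⟨e, rfl⟩ := Ext.mk₀_bijective _ _ |>.2 e
      rw [Ext.mk₀_comp_mk₀] at he
      have h2 := (Ext.mk₀_bijective _ _).1 he
      exact ⟨e.hom, LinearMap.ext fun x => congrArg (fun f => f.hom x) h2⟩
    · have := h (1 + k) (by omega) (by omega)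
      obtain ⟨e', rfl⟩ := Ext.contravariant_sequence_exact₁ hS _ e rfl (Subsingleton.elim _ _)
      rw [hz k h1 e', Ext.comp_zero]
  · rintro ⟨h, h'⟩ k h1 hk
    refine subsingleton_of_forall_eq 0 fun e => ?_
    obtain ⟨m, rfl⟩ := Nat.exists_eq_add_of_le h1
    obtain ⟨e', rfl⟩ := Ext.contravariant_sequence_exact₃ hS _ e (hz _ h1 _) rfl
    -- In degree one the class comes from an actual map `g` on `K`, and it dies because `g` extends
    -- to `P`; in higher degrees it comes from a vanishing Ext group of `K`.
    rcases m with _ | m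
    · obtain ⟨g, rfl⟩ := Ext.mk₀_bijective _ _ |>.2 e'
      obtain ⟨l, hl⟩ := h g.hom
      have : g = ModuleCat.ofHom i ≫ ModuleCat.ofHom l := by
        ext x; exact (LinearMap.congr_fun hl x).symm
      rw [this, ← Ext.mk₀_comp_mk₀, hS.extClass_comp_assoc]
    · have := h' (m + 1) (by omega) (by omega)
      rw [Subsingleton.elim e' 0, Ext.comp_zero]

/-- Dimension shifting in the second variable. -/
lemma extVanishing_succ_iff_right {i : K →ₗ[A] P} {p : P →ₗ[A] X} (hi : Function.Injective i)
    (hp : Function.Surjective p) (hex : Function.Exact i p) [Module.Injective A P] (n : ℕ) :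
    ExtVanishing A Y K (n + 1) ↔
      (∀ g : Y →ₗ[A] X, ∃ h : Y →ₗ[A] P, p ∘ₗ h = g) ∧ ExtVanishing A Y X n := by
  have hS := shortExact_of hi hp hex
  have : Injective (ModuleCat.of A P) := Module.injective_object_of_injective_module A P
  have hz (k : ℕ) (h1 : 1 ≤ k) (e : Ext.{u} (ModuleCat.of A Y) (ModuleCat.of A P) k) : e = 0 := by
    obtain ⟨m, rfl⟩ := Nat.exists_eq_add_of_le' h1
    exact Ext.eq_zero_of_injective e
  constructor
  · intro h
    refine ⟨fun g => ?_, fun k h1 hk => subsingleton_of_forall_eq 0 fun e => ?_⟩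
    · have := h 1 le_rfl (by omega)
      obtain ⟨e, he⟩ := Ext.covariant_sequence_exact₃ _ hS (Ext.mk₀ (ModuleCat.ofHom g))
        (n₁ := 1) rfl (Subsingleton.elim _ _)
      obtain ⟨e, rfl⟩ := Ext.mk₀_bijective _ _ |>.2 e
      rw [Ext.mk₀_comp_mk₀] at he
      have h2 := (Ext.mk₀_bijective _ _).1 he
      exact ⟨e.hom, LinearMap.ext fun x => congrArg (fun f => f.hom x) h2⟩
    · have := h (k + 1) (by omega) (by omega)
      obtain ⟨e', rfl⟩ := Ext.covariant_sequence_exact₃ _ hS e rfl (Subsingleton.elim _ _)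
      rw [hz k h1 e', Ext.zero_comp]
  · rintro ⟨h, h'⟩ k h1 hk
    refine subsingleton_of_forall_eq 0 fun e => ?_
    obtain ⟨m, rfl⟩ := Nat.exists_eq_add_of_le' h1
    obtain ⟨e', rfl⟩ := Ext.covariant_sequence_exact₁ _ hS e (hz _ h1 _) rfl
    rcases m with _ | m
    · obtain ⟨g, rfl⟩ := Ext.mk₀_bijective _ _ |>.2 e'
      obtain ⟨l, hl⟩ := h g.hom
      have : g = ModuleCat.ofHom l ≫ ModuleCat.ofHom p := by
        ext x; exact (LinearMap.congr_fun hl x).symm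
      rw [this, ← Ext.mk₀_comp_mk₀, Ext.comp_assoc_of_second_deg_zero, hS.comp_extClass, Ext.comp_zero]
    · have := h' (m + 1) (by omega) (by omega)
      rw [Subsingleton.elim e' 0, Ext.zero_comp]

lemma ExtVanishing.congr_left {X' : Type u} [AddCommGroup X'] [Module A X'] (e : X ≃ₗ[A] X')
    {n : ℕ} (h : ExtVanishing A X Y n) : ExtVanishing A X' Y n := fun k h1 hk => by
  have := h k h1 hk
  refine subsingleton_of_forall_eq 0 fun x => ?_
  rw [← Ext.mk₀_id_comp x, ← e.toModuleIso.inv_hom_id, ← Ext.mk₀_comp_mk₀,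
    Ext.comp_assoc _ _ _ (zero_add 0) (zero_add k) (by omega),
    Subsingleton.elim ((Ext.mk₀ e.toModuleIso.hom).comp x (zero_add k)) 0, Ext.comp_zero]

lemma ExtVanishing.congr_right {Y' : Type u} [AddCommGroup Y'] [Module A Y'] (e : Y ≃ₗ[A] Y')
    {n : ℕ} (h : ExtVanishing A X Y n) : ExtVanishing A X Y' n := fun k h1 hk => by
  have := h k h1 hk
  refine subsingleton_of_forall_eq 0 fun x => ?_
  rw [← Ext.comp_mk₀_id x, ← e.toModuleIso.inv_hom_id, ← Ext.mk₀_comp_mk₀,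
    ← Ext.comp_assoc _ _ _ (add_zero k) (zero_add 0) (by omega),
    Subsingleton.elim (x.comp (Ext.mk₀ e.toModuleIso.inv) (add_zero k)) 0, Ext.zero_comp]

end ExtVanishing

/-! ### Factoring linear maps through surjections, injections and ranges -/

section LinearAlgebra

variable {A : Type u} [Ring A] {P X N : Type u} [AddCommGroup P] [Module A P]
  [AddCommGroup X] [Module A X] [AddCommGroup N] [Module A N]

/-- A linear map which vanishes on the kernel of a surjection descends. -/
lemma exists_descend {c : P →ₗ[A] X} (hc : Function.Surjective c) (f : P →ₗ[A] N)
    (hf : ∀ p, c p = 0 → f p = 0) : ∃ g : X →ₗ[A] N, ∀ p, g (c p) = f p := by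
  refine ⟨(LinearMap.ker c).liftQ f hf ∘ₗ (c.quotKerEquivOfSurjective hc).symm, fun p => ?_⟩
  have : (c.quotKerEquivOfSurjective hc).symm (c p) = Submodule.Quotient.mk p := by
    rw [LinearEquiv.symm_apply_eq]; rfl
  rw [LinearMap.comp_apply, LinearEquiv.coe_coe, this]
  rfl

/-- A linear map with values in the range of an injection factors. -/
lemma exists_factor_injective {i : N →ₗ[A] X} (hi : Function.Injective i) (f : P →ₗ[A] X)
    (hf : ∀ p, ∃ y, i y = f p) : ∃ g : P →ₗ[A] N, ∀ p, i (g p) = f p :=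
  ⟨(LinearEquiv.ofInjective i hi).symm ∘ₗ f.codRestrict (LinearMap.range i) hf, fun p =>
    congrArg Subtype.val
      ((LinearEquiv.ofInjective i hi).apply_symm_apply (f.codRestrict (LinearMap.range i) hf p))⟩

/-- A linear map from a projective module with values in the range of `i` factors. -/
lemma exists_lift_range [Module.Projective A P] (i : N →ₗ[A] X) (f : P →ₗ[A] X)
    (hf : ∀ p, ∃ y, i y = f p) : ∃ g : P →ₗ[A] N, ∀ p, i (g p) = f p := by
  obtain ⟨g, hg⟩ := Module.projective_lifting_property i.rangeRestrict
    (f.codRestrict (LinearMap.range i) hf) i.surjective_rangeRestrict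
  exact ⟨g, fun p => congrArg Subtype.val (LinearMap.congr_fun hg p)⟩

end LinearAlgebra

/-! ### Morphisms of the projectively stable category -/

section Stable

variable {A : Type u} [Ring A]

lemma projRel_intro {X Y : FGModuleCat.{u} A} {f g : X ⟶ Y} (P : Type u) [AddCommGroup P]
    [Module A P] [Module.Finite A P] [Module.Projective A P] (a : X →ₗ[A] P) (b : P →ₗ[A] Y)
    (h : ∀ x, f.hom.hom x - g.hom.hom x = b (a x)) : projRel A f g :=
  ⟨FGModuleCat.of A P, inferInstanceAs (Module.Projective A P), FGModuleCat.ofHom a,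
    FGModuleCat.ofHom b, by ext x; exact h x⟩

/-- A morphism of `mod A` as a morphism of the projectively stable category. -/
abbrev stab {X Y : FGModuleCat.{u} A} (f : X ⟶ Y) : (⟨X⟩ : PStable A) ⟶ ⟨Y⟩ :=
  (CategoryTheory.Quotient.functor (projRel A)).map f

lemma isIso_stab {X Y : FGModuleCat.{u} A} (f : X ⟶ Y) (g : Y ⟶ X)
    (h : projRel A (f ≫ g) (𝟙 X)) (h' : projRel A (g ≫ f) (𝟙 Y)) : IsIso (stab f) :=
  ⟨stab g, by
    rw [← Functor.map_comp]
    exact CategoryTheory.Quotient.sound _ h, by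
    rw [← Functor.map_comp]
    exact CategoryTheory.Quotient.sound _ h'⟩

lemma exists_stab {X Y : PStable A} (f : X ⟶ Y) : ∃ g : X.as ⟶ Y.as, f = stab g :=
  ⟨_, ((CategoryTheory.Quotient.functor (projRel A)).map_preimage f).symm⟩

lemma exists_presMap_lift [IsNoetherianRing A] {T S : Type u} [AddCommGroup T] [Module A T]
    [Module.Finite A T] [AddCommGroup S] [Module A S] [Module.Projective A S]
    (w : S →ₗ[A] Cover A T) (hw : ∀ x, cover A T (w x) = 0) :
    ∃ s : S →ₗ[A] Cover A (Syz A T), ∀ x, presMap A T (s x) = w x :=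
  exists_lift_range _ w fun x => by
    obtain ⟨y, hy⟩ := cover_surjective A (Syz A T) ⟨w x, hw x⟩
    exact ⟨y, congrArg Subtype.val hy⟩

lemma cover_presMap [IsNoetherianRing A] {T : Type u} [AddCommGroup T] [Module A T]
    [Module.Finite A T] (x : Cover A (Syz A T)) : cover A T (presMap A T x) = 0 :=
  (cover A (Syz A T) x).2

lemma exists_presMap [IsNoetherianRing A] {T : Type u} [AddCommGroup T] [Module A T]
    [Module.Finite A T] (y : Cover A T) (hy : cover A T y = 0) : ∃ x, presMap A T x = y := by
  obtain ⟨x, hx⟩ := cover_surjective A (Syz A T) ⟨y, hy⟩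
  exact ⟨x, congrArg Subtype.val hx⟩

end Stable

/-! ### Reflexivity of finitely generated free modules with respect to a bimodule -/

section Reflexive

variable {A B : Type u} [Ring A] [Ring B] {L : Type u} [AddCommGroup L] [Module A L] [Module B L]
  [SMulCommClass A B L] [SMulCommClass B A L]

variable (B L) in
/-- Evaluation `P → Hom_B(Hom_A(P, L), L)`. -/
def evalDual (P : Type u) [AddCommGroup P] [Module A P] : P →ₗ[A] ((P →ₗ[A] L) →ₗ[B] L) where
  toFun p :=
    { toFun := fun φ => φ p
      map_add' := fun _ _ => rfl
      map_smul' := fun _ _ => rfl }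
  map_add' p q := LinearMap.ext fun φ => map_add φ p q
  map_smul' a p := LinearMap.ext fun φ => map_smul φ a p

/-- For P = Aⁿ the evaluation map is n copies of A → End_B(L), which is bijective by assumption. The
maps `s i` are the inclusions of the n copies of L into Hom(P, L). -/
lemma evalDual_bijective (hL : Function.Bijective (Module.toModuleEnd B (S := A) L)) (n : ℕ) :
    Function.Bijective (evalDual (A := A) B L (Fin n → A)) := by
  classical
  let s (i : Fin n) : L →ₗ[B] ((Fin n → A) →ₗ[A] L) :=
    { toFun := fun l => (LinearMap.toSpanSingleton A L l) ∘ₗ LinearMap.proj i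
      map_add' := fun l m => LinearMap.ext fun x => smul_add (x i) l m
      map_smul' := fun b l => LinearMap.ext fun x => smul_comm (x i) b l }
  have hs (i l) (x : Fin n → A) : s i l x = x i • l := rfl
  constructor
  · rw [injective_iff_map_eq_zero]
    intro p hp
    funext i
    refine hL.1 (LinearMap.ext fun l => ?_)
    rw [Pi.zero_apply, map_zero]
    exact LinearMap.congr_fun hp (s i l)
  · intro G
    -- Restricted to the i-th copy of L, the functional is a B-endomorphism of L, hence the action
    -- of a scalar; these scalars are the coordinates of the preimage.
    choose a ha using fun i => hL.2 (G ∘ₗ s i)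
    refine ⟨a, LinearMap.ext fun φ => ?_⟩
    have hφ : φ = ∑ i, s i (φ (Pi.single i 1)) := by
      refine LinearMap.ext fun x => ?_
      conv_lhs => rw [pi_eq_sum_univ' x, map_sum]
      rw [LinearMap.sum_apply]
      refine Finset.sum_congr rfl fun i _ => ?_
      rw [hs, ← map_smul]
    rw [hφ, map_sum, map_sum]
    refine Finset.sum_congr rfl fun i _ => ?_
    exact LinearMap.congr_fun (ha i) _

/-- The dual of a map `w : Hom_A(P, L) → S`, as a map to `P`, for finitely generated free `P`. -/
def dualTo (hL : Function.Bijective (Module.toModuleEnd B (S := A) L)) {n : ℕ}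
    {S : Type u} [AddCommGroup S] [Module B S] (w : ((Fin n → A) →ₗ[A] L) →ₗ[B] S) :
    (S →ₗ[B] L) →ₗ[A] (Fin n → A) :=
  (LinearEquiv.ofBijective _ (evalDual_bijective hL n)).symm ∘ₗ precomp A L w

/-- This characterizes `dualTo`, since forms separate the points of a free module; later
computations test elements of P against all forms in this way. -/
lemma apply_dualTo (hL : Function.Bijective (Module.toModuleEnd B (S := A) L)) {n : ℕ}
    {S : Type u} [AddCommGroup S] [Module B S] (w : ((Fin n → A) →ₗ[A] L) →ₗ[B] S)
    (ψ : S →ₗ[B] L) (φ : (Fin n → A) →ₗ[A] L) : φ (dualTo hL w ψ) = ψ (w φ) :=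
  LinearMap.congr_fun
    ((LinearEquiv.ofBijective _ (evalDual_bijective hL n)).apply_symm_apply (precomp A L w ψ)) φ

end Reflexive

/-! ### The double transpose is stably the identity -/

section DoubleTranspose

section

variable (A B : Type u) [Ring A] [Ring B] (L : Type u) [AddCommGroup L] [Module A L] [Module B L]
  [SMulCommClass A B L] [IsNoetherianRing A] (M : Type u) [AddCommGroup M] [Module A M]
  [Module.Finite A M]

/-- The projection onto the transpose. -/
abbrev trMk : (Cover A (Syz A M) →ₗ[A] L) →ₗ[B] Transpose A B L M := Submodule.mkQ _

lemma trMk_surjective : Function.Surjective (trMk A B L M) := Submodule.mkQ_surjective _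

variable {A B L M}

lemma trMk_eq_zero_iff (φ : Cover A (Syz A M) →ₗ[A] L) :
    trMk A B L M φ = 0 ↔ ∃ χ : Cover A M →ₗ[A] L, precomp B L (presMap A M) χ = φ :=
  Submodule.Quotient.mk_eq_zero _

end

variable {A B : Type u} [Ring A] [Ring B] {L : Type u} [AddCommGroup L] [Module A L] [Module B L]
  [SMulCommClass A B L] [SMulCommClass B A L]

/-- Linear forms separate points of a finitely generated free module. -/
lemma ext_linearForm (hL : Function.Bijective (Module.toModuleEnd B (S := A) L)) {n : ℕ}
    {p q : Fin n → A} (h : ∀ φ : (Fin n → A) →ₗ[A] L, φ p = φ q) :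
    p = q :=
  (evalDual_bijective hL n).1 (LinearMap.ext h)

variable [IsNoetherianRing A] [IsNoetherianRing B]
  [Module.Finite A L] [Module.Finite B L] [Module.Projective A L] [Module.Projective B L]

variable (B L) in
/-- A comparison of the dual of the chosen presentation of `X` with the chosen presentation of the
transpose of `X`. -/
structure DualComparison (X : FGModuleCat.{u} A) where
  /-- the component on `Hom(P₁, L)` -/
  zero : (Cover A (Syz A X) →ₗ[A] L) →ₗ[B] Cover B (trObj B L X)
  /-- the component on `Hom(P₀, L)` -/
  one : (Cover A X →ₗ[A] L) →ₗ[B] Cover B (Syz B (trObj B L X))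
  cover_zero (φ) : cover B (trObj B L X) (zero φ) = trMk A B L X φ
  presMap_one (φ) : presMap B (trObj B L X) (one φ) = zero (precomp B L (presMap A X) φ)

variable (B L) in
omit [SMulCommClass B A L] [Module.Finite A L] [Module.Projective A L] in
-- Hom(P₁, L) and Hom(P₀, L) are projective over B, so the identity of Tr X lifts to a map from the
-- dual presentation to the chosen one.
lemma nonempty_dualComparison (X : FGModuleCat.{u} A) : Nonempty (DualComparison B L X) := by
  obtain ⟨α, hα⟩ := Module.projective_lifting_property (cover B (trObj B L X)) (trMk A B L X)
    (cover_surjective _ _)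
  obtain ⟨β, hβ⟩ := exists_presMap_lift (α ∘ₗ precomp B L (presMap A X)) fun φ => by
    have := LinearMap.congr_fun hα (precomp B L (presMap A X) φ)
    exact this.trans ((trMk_eq_zero_iff _).mpr ⟨φ, rfl⟩)
  exact ⟨⟨α, β, LinearMap.congr_fun hα, hβ⟩⟩

variable (B L) in
/-- A chosen comparison. -/
def dualComparison (X : FGModuleCat.{u} A) : DualComparison B L X :=
  Classical.choice (nonempty_dualComparison B L X)

variable (hL : Function.Bijective (Module.toModuleEnd B (S := A) L))

include hL in
omit [IsNoetherianRing B] [Module.Finite A L] [Module.Finite B L] [Module.Projective A L]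
  [Module.Projective B L] in
/-- An element of `P₀` on which linear forms factor through the dual of the presentation of `X`
vanishes in `X`. -/
lemma cover_eq_zero_of {X : FGModuleCat.{u} A} (p : Cover A X)
    (G : (Cover A (Syz A X) →ₗ[A] L) →ₗ[B] L)
    (h : ∀ φ : Cover A X →ₗ[A] L, φ p = G (precomp B L (presMap A X) φ)) : cover A X p = 0 := by
  -- By reflexivity `G` is evaluation at some x in P₁, so `p` is the boundary of x.
  obtain ⟨x, rfl⟩ := (evalDual_bijective hL _).2 G
  have : p = presMap A X x := ext_linearForm hL h
  rw [this, cover_presMap]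

/-- The natural map `Tr Tr X → X`. -/
def etaLin (X : FGModuleCat.{u} A) : Transpose B A L (trObj B L X) →ₗ[A] X :=
  Submodule.liftQ _ (cover A X ∘ₗ dualTo hL (dualComparison B L X).one) (by
    rintro _ ⟨χ, rfl⟩
    -- Since the comparison commutes with the presentations, the witness in the double dual of P₁ is
    -- `χ` pulled back along its degree-zero component.
    refine cover_eq_zero_of hL _ (χ ∘ₗ (dualComparison B L X).zero) fun φ => ?_
    rw [apply_dualTo]
    exact congrArg χ ((dualComparison B L X).presMap_one φ))

omit [Module.Finite A L] [Module.Projective A L] in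
lemma etaLin_mk (X : FGModuleCat.{u} A)
    (ψ : Cover B (Syz B (trObj B L X)) →ₗ[B] L) :
    etaLin hL X (trMk B A L (trObj B L X) ψ) = cover A X (dualTo hL (dualComparison B L X).one ψ) := rfl

/-- The natural morphism `Tr Tr X → X`. -/
def etaHom (X : FGModuleCat.{u} A) : trObj A L (trObj B L X) ⟶ X := FGModuleCat.ofHom (etaLin hL X)

omit [Module.Projective A L] in
-- Two lifts of the map Tr Y → Tr X to presentations are compared: the chosen one and the dual of
-- the chosen lift of `f`. They are homotopic, and dualizing the homotopy back shows that the
-- naturality square commutes up to a map through the free cover of Y.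
lemma etaHom_naturality {X Y : FGModuleCat.{u} A} (f : X ⟶ Y) :
    projRel A (trMap A L (trMap B L f) ≫ etaHom hL Y) (etaHom hL X ≫ f) := by
  let C := dualComparison B L X
  let C' := dualComparison B L Y
  let h₀ := coverLift f.hom.hom
  let h₁ := coverLift (syzMap f.hom.hom)
  let t : trObj B L Y ⟶ trObj B L X := trMap B L f
  let l₀ := coverLift t.hom.hom
  let l₁ := coverLift (syzMap t.hom.hom)
  have hh (x) : presMap A Y (h₁ x) = h₀ (presMap A X x) := presMap_lift f x
  have hl (x) : presMap B _ (l₁ x) = l₀ (presMap B _ x) := presMap_lift t x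
  have hpre (φ : Cover A Y →ₗ[A] L) : precomp B L (presMap A X) (precomp B L h₀ φ) =
      precomp B L h₁ (precomp B L (presMap A Y) φ) :=
    LinearMap.ext fun x => congrArg φ (hh x).symm
  let w₀ : (Cover A (Syz A Y) →ₗ[A] L) →ₗ[B] Cover B (trObj B L X) :=
    l₀ ∘ₗ C'.zero - C.zero ∘ₗ precomp B L h₁
  -- Both lifts cover the same map of transposes, so their difference in degree zero is a boundary;
  -- `s` is the homotopy.
  obtain ⟨s, hs⟩ := exists_presMap_lift w₀ fun φ => by
    have h1 : cover B (trObj B L X) (l₀ (C'.zero φ)) = trMk A B L X (precomp B L h₁ φ) := by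
      rw [cover_coverLift, C'.cover_zero]; rfl
    rw [LinearMap.sub_apply, map_sub, LinearMap.comp_apply, LinearMap.comp_apply, h1,
      C.cover_zero]
    exact sub_self (trMk A B L X _)
  -- The degree-one difference corrected by the homotopy. It takes values in cycles, which is what
  -- lets its dual descend to Tr Tr X.
  let z : (Cover A Y →ₗ[A] L) →ₗ[B] Cover B (Syz B (trObj B L X)) :=
    l₁ ∘ₗ C'.one - C.one ∘ₗ precomp B L h₀ - s ∘ₗ precomp B L (presMap A Y)
  have hz (φ) : presMap B (trObj B L X) (z φ) = 0 := by
    simp only [z, LinearMap.sub_apply, LinearMap.comp_apply, map_sub, hs, hl, C.presMap_one,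
      C'.presMap_one, hpre, w₀]
    simp
  let a : Transpose B A L (trObj B L X) →ₗ[A] Cover A Y :=
    Submodule.liftQ _ (dualTo hL z) (by
      rintro _ ⟨χ, rfl⟩
      refine ext_linearForm hL fun φ => ?_
      rw [apply_dualTo, map_zero]
      exact (congrArg χ (hz φ)).trans (map_zero χ))
  refine projRel_intro (Cover A Y) a (cover A Y) fun x => ?_
  obtain ⟨ψ, rfl⟩ := trMk_surjective B A L (trObj B L X) x
  change cover A Y (dualTo hL C'.one (precomp A L l₁ ψ)) - f.hom.hom (cover A X (dualTo hL C.one ψ))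
    = cover A Y (dualTo hL z ψ)
  rw [← cover_coverLift, ← sub_eq_zero, ← map_sub, ← map_sub]
  -- The remaining discrepancy is the dual of the homotopy term, a boundary in the cover of Y, and
  -- so it vanishes in Y.
  refine cover_eq_zero_of hL _ (ψ ∘ₗ s) fun φ => ?_
  have h1 : φ (coverLift f.hom.hom (dualTo hL C.one ψ)) = ψ (C.one (precomp B L h₀ φ)) :=
    apply_dualTo hL C.one ψ (precomp B L h₀ φ)
  rw [map_sub, map_sub, apply_dualTo, apply_dualTo, h1]
  change ψ (l₁ (C'.one φ)) - _ - ψ (l₁ (C'.one φ) - C.one (precomp B L h₀ φ) -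
    s (precomp B L (presMap A Y) φ)) = ψ (s (precomp B L (presMap A Y) φ))
  simp

/-- A comparison `β` in the opposite direction, from the chosen presentation of Tr X to the dual
presentation, dualizes to a candidate inverse X → Tr Tr X. The two composites of comparisons are
homotopic to the identity because both lift the identity of Tr X. -/
lemma isIso_stab_etaHom (X : FGModuleCat.{u} A) : IsIso (stab (etaHom (B := B) hL X)) := by
  let C := dualComparison B L X
  obtain ⟨β₀, hβ₀⟩ := Module.projective_lifting_property (trMk A B L X) (cover B (trObj B L X))
    (trMk_surjective A B L X)
  replace hβ₀ (x) : trMk A B L X (β₀ x) = cover B (trObj B L X) x := LinearMap.congr_fun hβ₀ x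
  obtain ⟨β₁, hβ₁⟩ := exists_lift_range (precomp B L (presMap A X))
    (β₀ ∘ₗ presMap B (trObj B L X)) fun x => by
      rw [← trMk_eq_zero_iff]
      exact (hβ₀ _).trans (cover_presMap x)
  obtain ⟨θ, hθ⟩ := exists_descend (cover_surjective A X)
    (trMk B A L (trObj B L X) ∘ₗ precomp A L β₁ ∘ₗ evalDual B L (Cover A X)) fun p hp => by
      obtain ⟨x, rfl⟩ := exists_presMap p hp
      refine (trMk_eq_zero_iff _).mpr ⟨evalDual B L _ x ∘ₗ β₀, LinearMap.ext fun q => ?_⟩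
      exact (LinearMap.congr_fun (hβ₁ q) x).symm
  refine isIso_stab _ (FGModuleCat.ofHom θ) ?_ ?_
  · have h1 : etaHom hL X ≫ FGModuleCat.ofHom θ = trInd A L (X := trObj B L X) (Y := trObj B L X)
        (C.one ∘ₗ β₁) (C.zero ∘ₗ β₀) (fun x => by
          rw [LinearMap.comp_apply, C.presMap_one, hβ₁]; rfl) := by
      ext x
      obtain ⟨ψ, rfl⟩ := trMk_surjective B A L (trObj B L X) x
      change θ (cover A X (dualTo hL C.one ψ)) = trMk B A L (trObj B L X) (precomp A L (C.one ∘ₗ β₁) ψ)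
      rw [hθ]
      refine congrArg (trMk B A L (trObj B L X)) (LinearMap.ext fun q => ?_)
      exact apply_dualTo hL C.one ψ (β₁ q)
    have h2 : 𝟙 (trObj A L (trObj B L X)) = trInd A L (X := trObj B L X) (Y := trObj B L X)
        LinearMap.id LinearMap.id (fun _ => rfl) := by
      ext x
      obtain ⟨φ, rfl⟩ := trMk_surjective B A L (trObj B L X) x
      rfl
    exact (congrArg₂ (fun a b => projRel A a b) h1 h2).mpr
      (tr_rel A L (projRel_of_eq (f := 𝟙 _) rfl) _ _
        (fun x => (C.cover_zero _).trans (hβ₀ x)) (fun _ => rfl) _ _ _ _)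
  -- Here `β` after `C` is compared with the identity of the dual presentation, through a homotopy
  -- `s`. The corrected difference `z` is killed by the dual of P₁ → P₀, so its dual vanishes on the
  -- boundaries in P₀ and descends to a map X → P₀.
  · obtain ⟨s, hs⟩ := exists_lift_range (precomp B L (presMap A X))
      (β₀ ∘ₗ C.zero - LinearMap.id) fun φ => by
        rw [← trMk_eq_zero_iff, LinearMap.sub_apply, map_sub, LinearMap.comp_apply, hβ₀,
          C.cover_zero]
        exact sub_self _
    let z : (Cover A X →ₗ[A] L) →ₗ[B] (Cover A X →ₗ[A] L) :=
      β₁ ∘ₗ C.one - LinearMap.id - s ∘ₗ precomp B L (presMap A X)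
    have hz (φ) : precomp B L (presMap A X) (z φ) = 0 := by
      simp only [z, LinearMap.sub_apply, LinearMap.comp_apply, map_sub, hs, hβ₁, C.presMap_one]
      simp
    obtain ⟨a, ha⟩ := exists_descend (cover_surjective A X)
      (dualTo hL z ∘ₗ evalDual B L (Cover A X)) fun p hp => by
        obtain ⟨x, rfl⟩ := exists_presMap p hp
        refine ext_linearForm hL fun φ => ?_
        rw [LinearMap.comp_apply, apply_dualTo, map_zero]
        exact LinearMap.congr_fun (hz φ) x
    refine projRel_intro (Cover A X) a (cover A X) fun x => ?_
    obtain ⟨p, rfl⟩ := cover_surjective A X x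
    change etaLin hL X (θ (cover A X p)) - cover A X p = _
    rw [hθ, ha, LinearMap.comp_apply, etaLin_mk, ← sub_eq_zero, ← map_sub, ← map_sub]
    refine cover_eq_zero_of hL _ (evalDual B L _ p ∘ₗ s) fun φ => ?_
    rw [map_sub, map_sub, apply_dualTo, LinearMap.comp_apply (dualTo hL z), apply_dualTo]
    change (β₁ (C.one φ)) p - φ p - (β₁ (C.one φ) - φ - s (precomp B L (presMap A X) φ)) p =
      s (precomp B L (presMap A X) φ) p
    simp

/-- The natural transformation `Tr Tr ⟶ 𝟭`. -/
def etaNat : tr A B L ⋙ (tr B A L).leftOp ⟶ 𝟭 (PStable A) where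
  app X := stab (etaHom hL X.as)
  naturality X Y f := by
    obtain ⟨g, rfl⟩ := exists_stab f
    have := CategoryTheory.Quotient.sound _ (etaHom_naturality (B := B) hL g)
    rw [Functor.map_comp, Functor.map_comp] at this
    exact this

instance isIso_etaNat : IsIso (etaNat (B := B) hL) :=
  have (X : PStable A) : IsIso ((etaNat (B := B) hL).app X) := isIso_stab_etaHom hL X.as
  NatIso.isIso_of_isIso_app _

end DoubleTranspose

/-! ### Schanuel's lemma: kernels of projective covers and chosen syzygies -/

section SyzygyComparison

variable {B : Type u} [Ring B] {P T U P' T' U' : Type u} [AddCommGroup P] [Module B P]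
  [AddCommGroup T] [Module B T] [Module.Finite B T] [AddCommGroup U] [Module B U]
  [AddCommGroup P'] [Module B P']
  [AddCommGroup T'] [Module B T'] [Module.Finite B T'] [AddCommGroup U'] [Module B U']
  [Module.Projective B P] [Module.Projective B P']

lemma exists_coverComparison (p : P →ₗ[B] T) :
    ∃ γ : P →ₗ[B] Cover B T, ∀ x, cover B T (γ x) = p x := by
  obtain ⟨γ, hγ⟩ := Module.projective_lifting_property (cover B T) p (cover_surjective B T)
  exact ⟨γ, LinearMap.congr_fun hγ⟩

/-- A lift of a map from a projective module to the chosen cover of its target. -/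
def coverComparison (p : P →ₗ[B] T) : P →ₗ[B] Cover B T :=
  Classical.choose (exists_coverComparison p)

lemma cover_coverComparison (p : P →ₗ[B] T) (x : P) : cover B T (coverComparison p x) = p x :=
  Classical.choose_spec (exists_coverComparison p) x

/-- The map to the syzygy of `T` induced by a complex `U → P → T` with `P` projective. -/
def syzComparison (p : P →ₗ[B] T) (i : U →ₗ[B] P) (h : ∀ x, p (i x) = 0) : U →ₗ[B] Syz B T :=
  (coverComparison p ∘ₗ i).codRestrict _ fun x => (cover_coverComparison p _).trans (h x)

lemma syzComparison_coe (p : P →ₗ[B] T) (i : U →ₗ[B] P) (h : ∀ x, p (i x) = 0) (x : U) :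
    (syzComparison p i h x).1 = coverComparison p (i x) := rfl

/-- The map to the syzygy is natural up to maps which factor through the projective module. -/
lemma syzComparison_naturality {p : P →ₗ[B] T} {i : U →ₗ[B] P} (h : ∀ x, p (i x) = 0)
    {p' : P' →ₗ[B] T'} {i' : U' →ₗ[B] P'} (h' : ∀ x, p' (i' x) = 0) {t : T' →ₗ[B] T}
    {a : P' →ₗ[B] P} {b : U' →ₗ[B] U} (ht : ∀ x, t (p' x) = p (a x))
    (hb : ∀ x, i (b x) = a (i' x)) :
    ∃ δ : P' →ₗ[B] Syz B T, ∀ x,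
      syzComparison p i h (b x) - syzMap t (syzComparison p' i' h' x) = δ (i' x) := by
  refine ⟨(coverComparison p ∘ₗ a - coverLift t ∘ₗ coverComparison p').codRestrict _
    fun x => ?_, fun x => Subtype.ext ?_⟩
  · rw [LinearMap.mem_ker, LinearMap.sub_apply, map_sub, LinearMap.comp_apply,
      LinearMap.comp_apply, cover_coverLift, cover_coverComparison, cover_coverComparison, ht,
      sub_self]
  · rw [AddSubgroupClass.coe_sub, syzMap_coe, syzComparison_coe, syzComparison_coe, hb]
    rfl

/-- The kernel of a surjection from a projective module is stably isomorphic to the syzygy. -/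
lemma exists_syzComparison_inverse {p : P →ₗ[B] T} {i : U →ₗ[B] P} (h : ∀ x, p (i x) = 0)
    (hi : Function.Injective i) (hp : Function.Surjective p)
    (hex : ∀ x, p x = 0 → ∃ y, i y = x) :
    ∃ (δ : Syz B T →ₗ[B] U) (k : P →ₗ[B] U) (k' : Cover B T →ₗ[B] Syz B T),
      (∀ x, δ (syzComparison p i h x) - x = k (i x)) ∧
        ∀ q, syzComparison p i h (δ q) - q = k' q.1 := by
  have hγ := cover_coverComparison p
  obtain ⟨γ', hγ'⟩ := Module.projective_lifting_property p (cover B T) hp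
  replace hγ' (x) : p (γ' x) = cover B T x := LinearMap.congr_fun hγ' x
  -- Lifts in both directions between `P` and the chosen cover restrict to the kernels. A round trip
  -- minus the identity, on either module, covers zero and so lands in the kernel; this provides the
  -- factorizations `k` and `k'`.
  obtain ⟨δ, hδ⟩ := exists_factor_injective hi (γ' ∘ₗ (LinearMap.ker (cover B T)).subtype)
    fun q => hex _ ((hγ' q.1).trans q.2)
  obtain ⟨k, hk⟩ := exists_factor_injective hi (γ' ∘ₗ coverComparison p - LinearMap.id)
    fun x => hex _ <| by
      rw [LinearMap.sub_apply, map_sub, LinearMap.comp_apply, hγ', hγ, LinearMap.id_apply,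
        sub_self]
  refine ⟨δ, k, (coverComparison p ∘ₗ γ' - LinearMap.id).codRestrict _ fun q => ?mem,
    fun x => hi ?_, fun q => Subtype.ext ?_⟩
  case mem =>
    rw [LinearMap.mem_ker, LinearMap.sub_apply, map_sub, LinearMap.comp_apply, hγ, hγ',
      LinearMap.id_apply, sub_self]
  · rw [hk, map_sub, hδ, LinearMap.comp_apply, Submodule.subtype_apply, syzComparison_coe]
    rfl
  · rw [AddSubgroupClass.coe_sub, syzComparison_coe, hδ]
    rfl

end SyzygyComparison

/-! ### The comparison of Tr with Ω Tr Ω and its iterates -/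

section SyzygyTranspose

variable {A B : Type u} [Ring A] [Ring B] {L : Type u} [AddCommGroup L] [Module A L] [Module B L]
  [SMulCommClass A B L] [IsNoetherianRing A] [Module.Finite B L]

variable (B L) in
/-- The projection onto the transpose, as an object of `mod B`. -/
def trProj (X : FGModuleCat.{u} A) : (Cover A (Syz A X) →ₗ[A] L) →ₗ[B] trObj B L X :=
  trMk A B L X

lemma trProj_surjective (X : FGModuleCat.{u} A) : Function.Surjective (trProj B L X) :=
  trMk_surjective A B L X

lemma trProj_eq_zero_iff {X : FGModuleCat.{u} A} (φ : Cover A (Syz A X) →ₗ[A] L) :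
    trProj B L X φ = 0 ↔ ∃ χ : Cover A X →ₗ[A] L, precomp B L (presMap A X) χ = φ :=
  trMk_eq_zero_iff φ

variable (B L) in
/-- The map `Tr X → Hom(P₂, L)`, which is injective if maps from the syzygy of `X` to `L` extend
to `P₀`. -/
def trEmb (X : FGModuleCat.{u} A) :
    trObj B L X →ₗ[B] (Cover A (Syz A (omegaObj X)) →ₗ[A] L) :=
  Submodule.liftQ (LinearMap.range (precomp B L (presMap A X)))
    (precomp B L (presMap A (omegaObj X))) (by
      rintro _ ⟨χ, rfl⟩
      refine LinearMap.ext fun x => ?_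
      refine (congrArg (fun y : Syz A X => χ y.1) (cover_presMap (T := omegaObj X) x)).trans ?_
      exact map_zero χ)

lemma trProj_trEmb (X : FGModuleCat.{u} A) (x : trObj B L X) :
    trProj B L (omegaObj X) (trEmb B L X x) = 0 := by
  obtain ⟨φ, rfl⟩ := trProj_surjective X x
  exact (trProj_eq_zero_iff _).mpr ⟨φ, rfl⟩

/-- With `trProj_trEmb`, this is exactness of Tr X → Hom(P₂, L) → Tr ΩX in the middle, which needs
no Ext hypothesis: Tr ΩX is the cokernel of Hom(P₁, L) → Hom(P₂, L). -/
lemma exists_trEmb {X : FGModuleCat.{u} A} (ψ : Cover A (Syz A (omegaObj X)) →ₗ[A] L)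
    (h : trProj B L (omegaObj X) ψ = 0) : ∃ x, trEmb B L X x = ψ := by
  obtain ⟨φ, rfl⟩ := (trProj_eq_zero_iff _).mp h
  exact ⟨trProj B L X φ, rfl⟩

/-- A form on P₁ that vanishes on the image of P₂ is a form on ΩX. The hypothesis, which amounts to
Ext¹(X, L) = 0, extends it to P₀, so it represents zero in Tr X. -/
lemma trEmb_injective {X : FGModuleCat.{u} A} (h : ∀ g : Syz A X →ₗ[A] L,
      ∃ k : Cover A X →ₗ[A] L, k ∘ₗ (LinearMap.ker (cover A X)).subtype = g) :
    Function.Injective (trEmb B L X) := by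
  rw [injective_iff_map_eq_zero]
  intro x hx
  obtain ⟨φ, rfl⟩ := trProj_surjective X x
  obtain ⟨g, hg⟩ := exists_descend (cover_surjective A (Syz A X)) φ fun p hp => by
    obtain ⟨y, rfl⟩ := exists_presMap p hp
    exact LinearMap.congr_fun hx y
  obtain ⟨k, hk⟩ := h g
  refine (trProj_eq_zero_iff _).mpr ⟨k, LinearMap.ext fun p => ?_⟩
  exact (LinearMap.congr_fun hk _).trans (hg p)

variable [IsNoetherianRing B] [Module.Projective B L]

variable (B L) in
/-- The natural morphism `Tr X → Ω Tr Ω X`. -/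
def kappaHom (X : FGModuleCat.{u} A) : trObj B L X ⟶ omegaObj (trObj B L (omegaObj X)) :=
  FGModuleCat.ofHom (syzComparison (trProj B L (omegaObj X)) (trEmb B L X) (trProj_trEmb X))

/-- The sequence Tr X → Hom(P₂, L) → Tr ΩX is strictly natural for the chosen lifts, because the
lift used in degree zero for `omegaMap f` is the one used in degree one for `f`. Only the comparison
with the chosen syzygy introduces an error, and that factors through a projective. -/
lemma kappaHom_naturality {X Y : FGModuleCat.{u} A} (f : X ⟶ Y) :
    projRel B (trMap B L f ≫ kappaHom B L X)
      (kappaHom B L Y ≫ omegaMap (trMap B L (omegaMap f))) := by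
  have key := syzComparison_naturality (trProj_trEmb (B := B) (L := L) X)
    (trProj_trEmb (B := B) (L := L) Y) (t := (trMap B L (omegaMap f)).hom.hom)
    (a := precomp B L (coverLift (syzMap (omegaMap f).hom.hom))) (b := (trMap B L f).hom.hom)
    (fun _ => rfl) fun x => by
      obtain ⟨φ, rfl⟩ := trProj_surjective Y x
      exact LinearMap.ext fun p => congrArg φ (presMap_lift (omegaMap f) p).symm
  obtain ⟨δ, hδ⟩ := key
  exact projRel_intro (Cover A (Syz A (omegaObj Y)) →ₗ[A] L) (trEmb B L Y) δ hδ

/-- Under the hypothesis Tr X is the kernel of Hom(P₂, L) → Tr ΩX, a surjection from a projective,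
so Schanuel's lemma applies. -/
lemma isIso_stab_kappaHom (X : FGModuleCat.{u} A) (h : ∀ g : Syz A X →ₗ[A] L,
      ∃ k : Cover A X →ₗ[A] L, k ∘ₗ (LinearMap.ker (cover A X)).subtype = g) :
    IsIso (stab (kappaHom B L X)) := by
  have key := exists_syzComparison_inverse (trProj_trEmb (B := B) (L := L) X)
    (trEmb_injective h) (trProj_surjective (omegaObj X)) exists_trEmb
  obtain ⟨δ, k, k', hk, hk'⟩ := key
  exact isIso_stab _ (FGModuleCat.ofHom δ)
    (projRel_intro (Cover A (Syz A (omegaObj X)) →ₗ[A] L) (trEmb B L X) k hk)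
    (projRel_intro (Cover B (trObj B L (omegaObj X)))
      (LinearMap.ker (cover B (trObj B L (omegaObj X)))).subtype k' hk')

variable (A B L) in
/-- The natural transformation given by `Tr X → Ω Tr Ω X`. -/
def kappaNat : omega A ⋙ tr A B L ⋙ (omega B).op ⟶ tr A B L where
  app X := (stab (kappaHom B L X.as)).op
  naturality X Y f := by
    obtain ⟨g, rfl⟩ := exists_stab f
    have := CategoryTheory.Quotient.sound _ (kappaHom_naturality (B := B) (L := L) g)
    rw [Functor.map_comp, Functor.map_comp] at this
    exact congrArg Quiver.Hom.op this.symm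

variable (A) in
/-- Iterated syzygies commute with the syzygy functor. -/
def omegaPowComm : (n : ℕ) → (omega A ⋙ omegaPow A n ≅ omegaPow A (n + 1))
  | 0 => Iso.refl _
  | n + 1 => Functor.isoWhiskerRight (omegaPowComm n) (omega A)

variable (A B L) in
/-- A transformation `Tr ⟶ Ωⁿ Tr Ωⁿ` induces `Ω Tr Ω ⟶ Ωⁿ⁺¹ Tr Ωⁿ Ω`. -/
def kappaShift (n : ℕ) (κ : omegaPow A n ⋙ tr A B L ⋙ (omegaPow B n).op ⟶ tr A B L) :
    (omega A ⋙ omegaPow A n) ⋙ tr A B L ⋙ (omegaPow B (n + 1)).op ⟶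
      omega A ⋙ tr A B L ⋙ (omega B).op where
  app X := (omega B).op.map (κ.app ((omega A).obj X))
  naturality _ _ f :=
    (Functor.whiskerLeft (omega A) (Functor.whiskerRight κ (omega B).op)).naturality f

variable (A B L) in
/-- The natural transformation given by `Tr X → Ωⁿ Tr Ωⁿ X`. -/
def kappaPow : (n : ℕ) → (omegaPow A n ⋙ tr A B L ⋙ (omegaPow B n).op ⟶ tr A B L)
  | 0 => Functor.whiskerLeft (tr A B L) (Functor.opId _).hom
  | n + 1 =>
    -- `omegaPow` applies the additional Ω last, while the recursion needs the comparison at ΩX;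
    -- `omegaPowComm` moves that Ω to the front.
    Functor.whiskerRight (omegaPowComm A n).inv (tr A B L ⋙ (omegaPow B (n + 1)).op) ≫
      kappaShift A B L n (kappaPow n) ≫ kappaNat A B L

end SyzygyTranspose

/-! ### Invertibility of the iterated comparisons under Ext vanishing -/

section

variable {A B : Type u} [Ring A] [Ring B] {L : Type u} [AddCommGroup L] [Module A L] [Module B L]
  [SMulCommClass A B L] [IsNoetherianRing A]

omit [IsNoetherianRing A] in
lemma extVanishing_succ_iff_syz (X : Type u) [AddCommGroup X] [Module A X] [Module.Finite A X]
    (Y : Type u) [AddCommGroup Y] [Module A Y] (n : ℕ) :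
    ExtVanishing A X Y (n + 1) ↔ (∀ g : Syz A X →ₗ[A] Y, ∃ k : Cover A X →ₗ[A] Y,
      k ∘ₗ (LinearMap.ker (cover A X)).subtype = g) ∧ ExtVanishing A (Syz A X) Y n :=
  extVanishing_succ_iff_left (Submodule.subtype_injective _) (cover_surjective A X)
    (LinearMap.exact_subtype_ker_map _) n

variable [Module.Finite B L] [IsNoetherianRing B] [Module.Projective B L]

/-- Dimension shifting splits the hypothesis into the two inputs of the recursion: extension of maps
from ΩX to P₀, which inverts Tr X → Ω Tr ΩX, and vanishing one degree lower for ΩX. -/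
lemma isIso_kappaPow (n : ℕ) (X : FGModuleCat.{u} A) (h : ExtVanishing A X L n) :
    IsIso ((kappaPow A B L n).app ⟨X⟩) := by
  induction n generalizing X with
  | zero => exact inferInstanceAs (IsIso ((Functor.opId (PStable B)).hom.app ((tr A B L).obj ⟨X⟩)))
  | succ n ih =>
    obtain ⟨h1, h2⟩ := (extVanishing_succ_iff_syz X L n).mp h
    have := isIso_stab_kappaHom (B := B) X h1
    have h3 := ih (omegaObj X) h2
    have h4 : IsIso ((kappaNat A B L).app ⟨X⟩) :=
      inferInstanceAs (IsIso (stab (kappaHom B L X)).op)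
    have h5 : IsIso ((omega B).op.map ((kappaPow A B L n).app ⟨omegaObj X⟩)) := inferInstance
    have h6 : IsIso ((tr A B L ⋙ (omegaPow B (n + 1)).op).map ((omegaPowComm A n).inv.app ⟨X⟩)) :=
      inferInstance
    exact IsIso.comp_isIso' h6 (IsIso.comp_isIso' h5 h4)

variable [SMulCommClass B A L] [Module.Finite A L] [Module.Projective A L]
  (hL : Function.Bijective (Module.toModuleEnd B (S := A) L))

/-- The natural transformation given by `Tr Ωⁿ Tr Ωⁿ X → X`. -/
def trPowCounit (n : ℕ) :
    (omegaPow A n ⋙ tr A B L) ⋙ (omegaPow B n ⋙ tr B A L).leftOp ⟶ 𝟭 (PStable A) :=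
  Functor.whiskerRight (kappaPow A B L n) (tr B A L).leftOp ≫ etaNat hL

/-- Apply Tr to Tr X ≅ Ωⁿ Tr Ωⁿ X and compose with Tr Tr X ≅ X. -/
lemma isIso_trPowCounit (n : ℕ) (X : FGModuleCat.{u} A) (h : ExtVanishing A X L n) :
    IsIso ((trPowCounit (B := B) hL n).app ⟨X⟩) := by
  have := isIso_kappaPow (B := B) n X h
  have h1 : IsIso ((tr B A L).leftOp.map ((kappaPow A B L n).app ⟨X⟩)) := inferInstance
  exact IsIso.comp_isIso' h1 (inferInstanceAs (IsIso ((etaNat (B := B) hL).app ⟨X⟩)))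

end

/-! ### The duality D: reflexivity, exactness and its effect on Ext -/

section DoubleDual

variable {R : Type u} [CommRing R] [IsArtinianRing R] {A B : Type u} [Ring A] [Ring B] [Algebra R A]
  [Algebra R B] {E : Type u} [AddCommGroup E] [Module R E] {j : SimpleSum R →ₗ[R] E}
  (hj : IsInjectiveEnvelope R j) [Module.Finite R A] [Module.Finite R B]

/-- An element of the dual of an object of `mod A`, as a linear form. -/
def dualForm (e : B ≃ₐ[R] Aᵐᵒᵖ) (X : FGModuleCat.{u} A) (φ : dualObj e hj X) : X.obj →ₗ[R] E :=
  Dual.toLin e φ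

variable (e : B ≃ₐ[R] Aᵐᵒᵖ) (e' : A ≃ₐ[R] Bᵐᵒᵖ)

omit [Module.Finite R B] in
lemma dualForm_smul (X : FGModuleCat.{u} A) (b : B) (φ : dualObj e hj X) (x : X) :
    dualForm hj e X (b • φ) x = dualForm hj e X φ ((e b).unop • x) := rfl

omit [Module.Finite R B] in
lemma dualForm_smul_base (X : FGModuleCat.{u} A) (r : R) (φ : dualObj e hj X) (x : X) :
    dualForm hj e X (r • φ) x = r • dualForm hj e X φ x := by
  change dualForm hj e X (algebraMap R B r • φ) x = _
  rw [dualForm_smul, AlgEquiv.commutes, MulOpposite.algebraMap_apply, MulOpposite.unop_op,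
    ← map_smul]
  exact congrArg (dualForm hj e X φ) (algebraMap_smul A r x)

/-- The evaluation map `X → D D X`. -/
def dualEval (he : ∀ a, (e (e' a).unop).unop = a) (X : FGModuleCat.{u} A) :
    X →ₗ[A] dualObj e' hj (dualObj e hj X) where
  toFun x := Dual.ofLin e'
    { toFun := fun φ => dualForm hj e X φ x
      map_add' := fun _ _ => rfl
      map_smul' := fun r φ => dualForm_smul_base hj e X r φ x }
  map_add' x y := Dual.ext e' fun φ => map_add (dualForm hj e X φ) x y
  map_smul' a x := Dual.ext e' fun φ => by
    change dualForm hj e X φ (a • x) = dualForm hj e X ((e' a).unop • φ) x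
    rw [dualForm_smul, he]

variable (he : ∀ a, (e (e' a).unop).unop = a)

/-- As a map of R-modules this is evaluation into the double dual with respect to E, which is
bijective because X has finite length over R. -/
lemma dualEval_bijective (X : FGModuleCat.{u} A) : Function.Bijective (dualEval hj e e' he X) := by
  have : Module.Finite R X.obj := Module.Finite.trans A X.obj
  have hb := hj.eval_bijective X.obj
  constructor
  · intro x y h
    exact hb.1 (LinearMap.ext fun φ => congrArg (fun Φ => dualForm hj e' _ Φ φ) h)
  · intro Φ
    let o (φ : X.obj →ₗ[R] E) : dualObj e hj X := Dual.ofLin e φ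
    obtain ⟨x, hx⟩ := hb.2
      { toFun := fun φ => dualForm hj e' _ Φ (o φ)
        map_add' := fun φ ψ => map_add (dualForm hj e' _ Φ) (o φ) (o ψ)
        map_smul' := fun r φ => by
          refine Eq.trans ?_ ((dualForm hj e' (dualObj e hj X) Φ).map_smul r (o φ))
          refine congrArg (dualForm hj e' _ Φ) (Dual.ext e fun x => ?_)
          exact (dualForm_smul_base hj e X r (o φ) x).symm }
    exact ⟨x, Dual.ext e' fun φ => LinearMap.congr_fun hx (Dual.toLin e φ)⟩

/-- The natural isomorphism `X ≅ D D X` in `mod A`. -/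
def dualEvalIso (X : FGModuleCat.{u} A) : X ≅ dualObj e' hj (dualObj e hj X) :=
  (LinearEquiv.ofBijective _ (dualEval_bijective hj e e' he X)).toFGModuleCatIso

lemma dualEvalIso_naturality {X Y : FGModuleCat.{u} A} (f : X ⟶ Y) :
    f ≫ (dualEvalIso hj e e' he Y).hom =
      (dualEvalIso hj e e' he X).hom ≫ dualMap e' hj (dualMap e hj f) := rfl

include e' he in
/-- Every map between duals is a dual. -/
lemma exists_dualMap_eq {X Y : FGModuleCat.{u} A} (g : dualObj e hj Y ⟶ dualObj e hj X) :
    ∃ f : X ⟶ Y, dualMap e hj f = g := by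
  let ev (X) := LinearEquiv.ofBijective _ (dualEval_bijective hj e e' he X)
  -- The preimage is the dual of `g` conjugated by the evaluation isomorphisms.
  refine ⟨FGModuleCat.ofHom ((ev Y).symm.toLinearMap ∘ₗ (dualMap e' hj g).hom.hom ∘ₗ
    (ev X).toLinearMap), ?_⟩
  ext φ
  refine Dual.ext e fun x => ?_
  have h1 := (ev Y).apply_symm_apply ((dualMap e' hj g).hom.hom (ev X x))
  exact congrArg (fun Φ => dualForm hj e' _ Φ φ) h1

/-- The isomorphism `𝟭 ≅ D D` on the injectively stable category. -/
def dualUnitI : 𝟭 (IStable A) ≅ dualIP e hj ⋙ dualPI e' hj :=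
  NatIso.ofComponents
    (fun X => (CategoryTheory.Quotient.functor (injRel A)).mapIso (dualEvalIso hj e e' he X.as))
    (fun {X Y} f => by
      obtain ⟨g, rfl⟩ : ∃ g : X.as ⟶ Y.as, f = (CategoryTheory.Quotient.functor (injRel A)).map g :=
        ⟨_, ((CategoryTheory.Quotient.functor (injRel A)).map_preimage f).symm⟩
      exact congrArg (CategoryTheory.Quotient.functor (injRel A)).map
        (dualEvalIso_naturality hj e e' he g))

/-- The isomorphism `D D ≅ 𝟭` on the opposite of the projectively stable category. -/
def dualCounitP : dualPI e hj ⋙ dualIP e' hj ≅ 𝟭 (PStable A)ᵒᵖ :=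
  NatIso.ofComponents
    (fun X => ((CategoryTheory.Quotient.functor (projRel A)).mapIso
      (dualEvalIso hj e e' he X.unop.as)).op)
    (fun {X Y} f => by
      obtain ⟨g, hg⟩ := exists_stab f.unop
      obtain rfl : f = (stab g).op := congrArg Quiver.Hom.op hg
      exact congrArg (fun h => ((CategoryTheory.Quotient.functor (projRel A)).map h).op)
        (dualEvalIso_naturality hj e e' he g).symm)

omit [Module.Finite R B] in
lemma dualMap_injective {X Y : FGModuleCat.{u} A} {f : X ⟶ Y}
    (hf : Function.Surjective f.hom.hom) : Function.Injective (dualMap e hj f).hom.hom := by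
  intro φ ψ h
  refine Dual.ext e fun x => ?_
  obtain ⟨y, rfl⟩ := hf x
  exact congrArg (fun Φ => dualForm hj e X Φ y) h

omit [Module.Finite R B] in
-- Linear forms extend along injections since E is injective over R.
lemma dualMap_surjective {X Y : FGModuleCat.{u} A} {f : X ⟶ Y}
    (hf : Function.Injective f.hom.hom) : Function.Surjective (dualMap e hj f).hom.hom := by
  intro φ
  obtain ⟨ψ, hψ⟩ := hj.injective_module.out (f.hom.hom.restrictScalars R) hf (dualForm hj e X φ)
  exact ⟨Dual.ofLin e ψ, Dual.ext e hψ⟩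

omit [Module.Finite R B] in
lemma dualMap_exact {X Y Z : FGModuleCat.{u} A} {f : X ⟶ Y} {g : Y ⟶ Z}
    (hg : Function.Surjective g.hom.hom) (h : Function.Exact f.hom.hom g.hom.hom) :
    Function.Exact (dualMap e hj g).hom.hom (dualMap e hj f).hom.hom := by
  intro φ
  constructor
  · intro h0
    obtain ⟨ψ, hψ⟩ := exists_descend (c := g.hom.hom.restrictScalars R) hg
      (dualForm hj e Y φ) fun p hp => by
        obtain ⟨x, rfl⟩ := (h p).mp hp
        exact congrArg (fun Φ => dualForm hj e X Φ x) h0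
    exact ⟨Dual.ofLin e ψ, Dual.ext e hψ⟩
  · rintro ⟨ψ, rfl⟩
    refine Dual.ext e fun x => ?_
    exact (congrArg (dualForm hj e Z ψ) (h.apply_apply_eq_zero x)).trans (map_zero _)

omit [Module.Finite R B] in
lemma injective_dualObj (X : FGModuleCat.{u} A) [Module.Projective A X] :
    Module.Injective B (dualObj e hj X) :=
  Dual.injective_of_projective e X.obj hj.injective_module

/-- The duality turns around extension groups. -/
lemma ExtVanishing.dual {n : ℕ} {X Y : FGModuleCat.{u} A} (he : ∀ a, (e (e' a).unop).unop = a)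
    (h : ExtVanishing A X Y n) :
    ExtVanishing B (dualObj e hj Y) (dualObj e hj X) n := by
  have := isNoetherianRing_of_finite R A
  induction n generalizing X with
  | zero => exact extVanishing_zero
  | succ n ih =>
    obtain ⟨h1, h2⟩ := (extVanishing_succ_iff_syz X.obj Y.obj n).mp h
    let C := FGModuleCat.of A (Cover A X)
    let c : C ⟶ X := FGModuleCat.ofHom (cover A X)
    let i : omegaObj X ⟶ C := FGModuleCat.ofHom (LinearMap.ker (cover A X)).subtype
    have hC : Module.Projective A C := inferInstanceAs (Module.Projective A (Cover A X))
    have := injective_dualObj hj e C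
    -- Dualizing 0 → ΩX → P₀ → X → 0 gives 0 → DX → DP₀ → DΩX → 0 with DP₀ injective, so the shift
    -- in the first variable becomes one in the second. A map DY → DΩX is dual to a map ΩX → Y, and
    -- extending the latter to P₀ lifts the former to DP₀.
    refine (extVanishing_succ_iff_right (dualMap_injective hj e (f := c) (cover_surjective A X))
      (dualMap_surjective hj e (f := i) (Submodule.subtype_injective _))
      (dualMap_exact hj e (f := i) (g := c) (cover_surjective A X)
        (LinearMap.exact_subtype_ker_map _)) n).mpr ⟨fun g => ?_, ih h2⟩
    have key := exists_dualMap_eq hj e e' he (X := omegaObj X) (Y := Y)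
      (ObjectProperty.homMk (ModuleCat.ofHom g))
    obtain ⟨f, hf⟩ := key
    obtain ⟨k, hk⟩ := h1 f.hom.hom
    refine ⟨(dualMap e hj (X := C) (FGModuleCat.ofHom k)).hom.hom, LinearMap.ext fun φ => ?_⟩
    refine Eq.trans ?_ (congrArg (fun q => q.hom.hom φ) hf)
    exact Dual.ext e fun x => congrArg (dualForm hj e Y φ) (LinearMap.congr_fun hk x)

end DoubleDual

/-! ### Maps from transposes to duals, for a bimodule isomorphic to the ring -/

section Regular

variable {A B : Type u} [Ring A] [Ring B] {L : Type u} [AddCommGroup L] [Module A L] [Module B L]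
  [SMulCommClass A B L]

/-- The scalar multiples `p ↦ φ(p) n` of an element of `N` by a form, for `L ≅ A`. -/
def formSMul (ρ : L ≃ₗ[A] A) {P N : Type u} [AddCommGroup P] [Module A P] [AddCommGroup N]
    [Module A N] (φ : P →ₗ[A] L) (n : N) : P →ₗ[A] N :=
  LinearMap.toSpanSingleton A N n ∘ₗ ρ.toLinearMap ∘ₗ φ

lemma formSMul_apply (ρ : L ≃ₗ[A] A) {P N : Type u} [AddCommGroup P] [Module A P] [AddCommGroup N]
    [Module A N] (φ : P →ₗ[A] L) (n : N) (p : P) : formSMul ρ φ n p = ρ (φ p) • n := rfl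

/-- The coordinate forms. -/
def coordForm (ρ : L ≃ₗ[A] A) {m : ℕ} (i : Fin m) : (Fin m → A) →ₗ[A] L :=
  ρ.symm.toLinearMap ∘ₗ LinearMap.proj i

lemma apply_coordForm (ρ : L ≃ₗ[A] A) {m : ℕ} (i : Fin m) (p : Fin m → A) :
    ρ (coordForm ρ i p) = p i := ρ.apply_symm_apply (p i)

lemma eq_sum_formSMul (ρ : L ≃ₗ[A] A) {m : ℕ} {N : Type u} [AddCommGroup N] [Module A N]
    (f : (Fin m → A) →ₗ[A] N) :
    f = ∑ i, formSMul ρ (coordForm ρ i) (f (Pi.single i 1)) := by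
  refine LinearMap.ext fun p => ?_
  conv_lhs => rw [pi_eq_sum_univ' p, map_sum]
  rw [LinearMap.sum_apply]
  refine Finset.sum_congr rfl fun i _ => ?_
  rw [formSMul_apply, apply_coordForm, ← map_smul]

variable {R : Type u} [CommRing R] [Algebra R A] [Algebra R B] (e : B ≃ₐ[R] Aᵐᵒᵖ)
  (ρ : L ≃ₗ[A] A) (hρ : ∀ (b : B) (l : L), ρ (b • l) = ρ l * (e b).unop)

include hρ in
-- Over B, which acts by right multiplication, L is generated by the element corresponding to 1. An
-- endomorphism is determined by its value there, and is the action of that value.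
lemma toModuleEnd_bijective [SMulCommClass B A L] :
    Function.Bijective (Module.toModuleEnd B (S := A) L) := by
  constructor
  · intro a a' h
    have h1 : a • ρ.symm 1 = a' • ρ.symm 1 := LinearMap.congr_fun h (ρ.symm 1)
    simpa using congrArg ρ h1
  · intro f
    refine ⟨ρ (f (ρ.symm 1)), LinearMap.ext fun l => ρ.injective ?_⟩
    have h1 : l = e.symm (MulOpposite.op (ρ l)) • ρ.symm 1 := ρ.injective (by rw [hρ]; simp)
    change ρ (ρ (f (ρ.symm 1)) • l) = ρ (f l)
    conv_rhs => rw [h1, map_smul, hρ]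
    simp

include hρ in
lemma eq_sum_coordForm {m : ℕ} (φ : (Fin m → A) →ₗ[A] L) :
    φ = ∑ i, e.symm (MulOpposite.op (ρ (φ (Pi.single i 1)))) • coordForm ρ i := by
  refine LinearMap.ext fun p => ρ.injective ?_
  conv_lhs => rw [pi_eq_sum_univ' p, map_sum, map_sum]
  rw [LinearMap.sum_apply, map_sum]
  refine Finset.sum_congr rfl fun i _ => ?_
  rw [LinearMap.smul_apply, hρ, apply_coordForm, AlgEquiv.apply_symm_apply, MulOpposite.unop_op,
    ← smul_eq_mul, ← map_smul, ← map_smul]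

variable [IsArtinianRing R] {E : Type u} [AddCommGroup E] [Module R E] {j : SimpleSum R →ₗ[R] E}
  (hj : IsInjectiveEnvelope R j) [Module.Finite R A]

/-- A map from a dual to `D N` is a linear form on `Hom_A(P, N)`, for finitely generated free
`P`. -/
lemma exists_form {m : ℕ} {N : FGModuleCat.{u} A}
    (hρ : ∀ (b : B) (l : L), ρ (b • l) = ρ l * (e b).unop)
    (g : ((Fin m → A) →ₗ[A] L) →ₗ[B] dualObj e hj N) :
    ∃ l : ((Fin m → A) →ₗ[A] N.obj) →ₗ[R] E,
      ∀ φ n, l (formSMul ρ φ n) = dualForm hj e N (g φ) n := by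
  -- A map f in Hom(P, N) is sent to the sum over i of g(xᵢ) evaluated at f(eᵢ), with xᵢ the
  -- coordinate forms; B-linearity of `g` gives the formula on all forms, as the xᵢ generate Hom(P,
  -- L).
  refine ⟨∑ i, dualForm hj e N (g (coordForm ρ i)) ∘ₗ
    (LinearMap.applyₗ' R (Pi.single i (1 : A)) : ((Fin m → A) →ₗ[A] N.obj) →ₗ[R] N.obj),
    fun φ n => ?_⟩
  conv_rhs => rw [eq_sum_coordForm e ρ hρ φ, map_sum]
  have h1 : dualForm hj e N (∑ i, g (e.symm (MulOpposite.op (ρ (φ (Pi.single i 1)))) •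
      coordForm ρ i)) n = ∑ i, dualForm hj e N (g (e.symm (MulOpposite.op
        (ρ (φ (Pi.single i 1)))) • coordForm ρ i)) n :=
    map_sum (AddMonoidHom.mk' (fun Φ : dualObj e hj N => dualForm hj e N Φ n) fun _ _ => rfl) _ _
  rw [h1, LinearMap.sum_apply]
  refine Finset.sum_congr rfl fun i _ => ?_
  rw [map_smul, dualForm_smul, AlgEquiv.apply_symm_apply]
  rfl

/-- A linear form on `Hom_A(P, N)` induces a map to `D N`. -/
lemma exists_ofForm {P : Type u} [AddCommGroup P] [Module A P] {N : FGModuleCat.{u} A}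
    (hρ : ∀ (b : B) (l : L), ρ (b • l) = ρ l * (e b).unop) (l : (P →ₗ[A] N.obj) →ₗ[R] E) :
    ∃ g : (P →ₗ[A] L) →ₗ[B] dualObj e hj N,
      ∀ φ n, dualForm hj e N (g φ) n = l (formSMul ρ φ n) :=
  ⟨{ toFun := fun φ => Dual.ofLin e
      { toFun := fun n => l (formSMul ρ φ n)
        map_add' := fun n n' => by
          rw [← map_add]
          exact congrArg l (LinearMap.ext fun p => smul_add _ _ _)
        map_smul' := fun r n => by
          rw [RingHom.id_apply, ← map_smul]
          exact congrArg l (LinearMap.ext fun p => smul_comm _ _ _) }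
     map_add' := fun φ ψ => Dual.ext e fun n => by
      refine Eq.trans (congrArg l (LinearMap.ext fun p => ?_))
        (map_add l (formSMul ρ φ n) (formSMul ρ ψ n))
      change ρ (φ p + ψ p) • (n : N.obj) = ρ (φ p) • n + ρ (ψ p) • n
      rw [map_add, add_smul]
     map_smul' := fun b φ => Dual.ext e fun n => by
      refine congrArg l (LinearMap.ext fun p => ?_)
      change ρ (b • φ p) • (n : N.obj) = ρ (φ p) • (e b).unop • n
      rw [hρ, mul_smul] }, fun _ _ => rfl⟩

variable [IsNoetherianRing A] [Module.Finite B L]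

/-- A map Tr X → DN is a linear form on Hom(P₁, N) that kills the image of Hom(P₀, N). By the
hypothesis, which amounts to Ext¹(X, N) = 0, this image is the kernel of Hom(P₁, N) → Hom(P₂, N).
The form thus descends to the range of that map, extends to Hom(P₂, N) since E is injective, and is
read back as a map Hom(P₂, L) → DN. -/
lemma exists_extend_trEmb {X N : FGModuleCat.{u} A}
    (hρ : ∀ (b : B) (l : L), ρ (b • l) = ρ l * (e b).unop)
    (h : ∀ g : Syz A X →ₗ[A] N,
      ∃ k : Cover A X →ₗ[A] N, k ∘ₗ (LinearMap.ker (cover A X)).subtype = g)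
    (g : trObj B L X →ₗ[B] dualObj e hj N) :
    ∃ k : (Cover A (Syz A (omegaObj X)) →ₗ[A] L) →ₗ[B] dualObj e hj N, k ∘ₗ trEmb B L X = g := by
  have key := exists_form e ρ hj hρ (g ∘ₗ trProj B L X)
  obtain ⟨l, hl⟩ := key
  let q : (Cover A (Syz A X) →ₗ[A] N.obj) →ₗ[R] (Cover A (Syz A (omegaObj X)) →ₗ[A] N.obj) :=
    precomp R N.obj (presMap A (omegaObj X))
  have h0 (f) (hf : q.rangeRestrict f = 0) : l f = 0 := by
    have hf' (y) : f (presMap A (omegaObj X) y) = 0 :=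
      LinearMap.congr_fun (congrArg Subtype.val hf) y
    obtain ⟨g₀, hg₀⟩ := exists_descend (cover_surjective A (Syz A X)) f fun p hp => by
      obtain ⟨y, rfl⟩ := exists_presMap p hp
      exact hf' y
    obtain ⟨f₀, hf₀⟩ := h g₀
    -- As `f` extends to P₀, expanding the extension in coordinates writes `f` through forms that
    -- are zero in Tr X, on which `l` vanishes.
    have h1 : f = ∑ i, formSMul ρ (precomp B L (presMap A X) (coordForm ρ i))
        (f₀ (Pi.single i 1)) := by
      have h2 : f = f₀ ∘ₗ presMap A X := LinearMap.ext fun p =>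
        ((LinearMap.congr_fun hf₀ _).trans (hg₀ p)).symm
      rw [h2]
      conv_lhs => rw [eq_sum_formSMul ρ f₀]
      refine LinearMap.ext fun p => ?_
      rw [LinearMap.comp_apply, LinearMap.sum_apply, LinearMap.sum_apply]
      rfl
    rw [h1, map_sum]
    refine Finset.sum_eq_zero fun i _ => ?_
    have h3 : trProj B L X (precomp B L (presMap A X) (coordForm ρ i)) = 0 :=
      (trProj_eq_zero_iff _).mpr ⟨_, rfl⟩
    rw [hl, LinearMap.comp_apply, h3, map_zero]
    rfl
  obtain ⟨l₁, hl₁⟩ := exists_descend q.surjective_rangeRestrict l h0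
  obtain ⟨l₂, hl₂⟩ := hj.injective_module.out (LinearMap.range q).subtype
    (Submodule.subtype_injective _) l₁
  have key := exists_ofForm e ρ hj hρ l₂
  obtain ⟨k, hk⟩ := key
  refine ⟨k, LinearMap.ext fun x => Dual.ext e fun n => ?_⟩
  obtain ⟨φ, rfl⟩ := trProj_surjective X x
  refine (hk _ _).trans (Eq.trans ?_ (hl φ n))
  exact (hl₂ (q.rangeRestrict (formSMul ρ φ n))).trans (hl₁ _)

/-- The iterated syzygy of an object of `mod A`. -/
abbrev omegaPowObj (n : ℕ) (X : FGModuleCat.{u} A) : FGModuleCat.{u} A :=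
  ((omegaPow A n).obj ⟨X⟩).as

omit [Module.Finite R A] in
lemma ExtVanishing.iterate {m n : ℕ} {X : FGModuleCat.{u} A} {Y : Type u} [AddCommGroup Y]
    [Module A Y] (h : ExtVanishing A X Y (m + n)) : ExtVanishing A (omegaPowObj n X) Y m := by
  induction n generalizing m with
  | zero => exact h
  | succ n ih =>
    exact ((extVanishing_succ_iff_syz (omegaPowObj n X).obj Y m).mp
      (ih (m := m + 1) (by rwa [add_assoc, add_comm 1]))).2

/-- Vanishing of extensions for the `n`-th transpose. -/
lemma extVanishing_trObj [Module.Projective B L] {X N : FGModuleCat.{u} A}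
    (hρ : ∀ (b : B) (l : L), ρ (b • l) = ρ l * (e b).unop) {n : ℕ}
    (hL : ExtVanishing A X L n) (hN : ExtVanishing A X N n) :
    ExtVanishing B (trObj B L (omegaPowObj n X)) (dualObj e hj N) n := by
  induction n with
  | zero => exact extVanishing_zero
  | succ n ih =>
    let Z := omegaPowObj n X
    -- Ext^{n+1}(X, -) is Ext¹ of the n-th syzygy, so only the top degree of each hypothesis is used
    -- here; the lower degrees feed the induction.
    have hZ := ((extVanishing_succ_iff_syz Z.obj L 0).mp
      (ExtVanishing.iterate (by rwa [add_comm]))).1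
    have hZ' := ((extVanishing_succ_iff_syz Z.obj N 0).mp
      (ExtVanishing.iterate (by rwa [add_comm]))).1
    -- Shift along 0 → Tr Z → Hom(P₂, L) → Tr ΩZ → 0, whose middle term is projective over B.
    refine (extVanishing_succ_iff_left (i := trEmb B L Z) (p := trProj B L (omegaObj Z))
      (trEmb_injective hZ) (trProj_surjective _) (fun ψ => ⟨exists_trEmb ψ, ?_⟩) n).mpr
      ⟨exists_extend_trEmb e ρ hj hρ hZ', ih (hL.mono n.le_succ) (hN.mono n.le_succ)⟩
    rintro ⟨x, rfl⟩
    exact trProj_trEmb Z x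

end Regular

/-! ### The cluster-tilting conditions as vanishing up to degree d-1 -/

section ClusterTiltingVanishing

variable {A : Type u} [Ring A] {d : ℕ} {𝓜 : ObjectProperty (FGModuleCat.{u} A)}
  (h𝓜 : IsClusterTilting d 𝓜)

include h𝓜

lemma IsClusterTilting.extVanishing {X Y : FGModuleCat.{u} A} (hX : 𝓜 X) (hY : 𝓜 Y) :
    ExtVanishing A X Y (d - 1) :=
  fun k h1 h2 => (h𝓜.mem_iff_ext_left X).mp hX k h1 (by omega) Y hY

lemma IsClusterTilting.mem_of_extVanishing_left {X : FGModuleCat.{u} A}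
    (h : ∀ Y, 𝓜 Y → ExtVanishing A X Y (d - 1)) : 𝓜 X :=
  (h𝓜.mem_iff_ext_left X).mpr fun k h1 h2 Y hY => h Y hY k h1 (by omega)

lemma IsClusterTilting.mem_of_extVanishing_right {Y : FGModuleCat.{u} A}
    (h : ∀ X, 𝓜 X → ExtVanishing A X Y (d - 1)) : 𝓜 Y :=
  (h𝓜.mem_iff_ext_right Y).mpr fun k h1 h2 X hX => h X hX k h1 (by omega)

end ClusterTiltingVanishing

/-! ### The translations preserve the cluster-tilting subcategory -/

section TranslationVanishing

variable (R : Type u) [CommRing R] [IsArtinianRing R] {A : Type u} [Ring A] [Algebra R A]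
  [Module.Finite R A] {E : Type u} [AddCommGroup E] [Module R E] {j : SimpleSum R →ₗ[R] E}
  (hj : IsInjectiveEnvelope R j) (d : ℕ)

lemma toModuleEnd_bijective_right (R : Type u) [CommRing R] (A : Type u) [Ring A] [Algebra R A] :
    Function.Bijective (Module.toModuleEnd A (S := Aᵐᵒᵖ) A) :=
  toModuleEnd_bijective (AlgEquiv.opOp R A) (opRegular A).symm fun _ _ => rfl

lemma toModuleEnd_bijective_left (R : Type u) [CommRing R] (A : Type u) [Ring A] [Algebra R A] :
    Function.Bijective (Module.toModuleEnd Aᵐᵒᵖ (S := A) A) :=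
  toModuleEnd_bijective (AlgEquiv.refl : Aᵐᵒᵖ ≃ₐ[R] Aᵐᵒᵖ) (LinearEquiv.refl A A) fun _ _ => rfl

variable {R}

/-- The dual of a right module. -/
abbrev dualRight (X : FGModuleCat.{u} Aᵐᵒᵖ) : FGModuleCat.{u} A :=
  haveI := finite_op R A
  dualObj (A := Aᵐᵒᵖ) (B := A) (AlgEquiv.opOp R A) hj X

/-- The dual of a left module. -/
abbrev dualLeft (X : FGModuleCat.{u} A) : FGModuleCat.{u} Aᵐᵒᵖ :=
  dualObj (A := A) (B := Aᵐᵒᵖ) AlgEquiv.refl hj X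

/-- The evaluation `X ≃ D D X` for right modules. -/
def evalRight (X : FGModuleCat.{u} Aᵐᵒᵖ) : X ≃ₗ[Aᵐᵒᵖ] dualLeft hj (dualRight hj X) :=
  haveI := finite_op R A
  LinearEquiv.ofBijective _
    (dualEval_bijective (A := Aᵐᵒᵖ) (B := A) hj (AlgEquiv.opOp R A) AlgEquiv.refl
      (fun _ => rfl) X)

/-- The evaluation `X ≃ D D X` for left modules. -/
def evalLeft (X : FGModuleCat.{u} A) : X ≃ₗ[A] dualRight hj (dualLeft hj X) :=
  haveI := finite_op R A
  LinearEquiv.ofBijective _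
    (dualEval_bijective (A := A) (B := Aᵐᵒᵖ) hj AlgEquiv.refl (AlgEquiv.opOp R A)
      (fun _ => rfl) X)

lemma ExtVanishing.dualRight {n : ℕ} {X Y : FGModuleCat.{u} Aᵐᵒᵖ} (h : ExtVanishing Aᵐᵒᵖ X Y n) :
    ExtVanishing A (dualRight hj Y) (dualRight hj X) n :=
  haveI := finite_op R A
  ExtVanishing.dual (A := Aᵐᵒᵖ) (B := A) hj (AlgEquiv.opOp R A) AlgEquiv.refl (fun _ => rfl) h

lemma ExtVanishing.dualLeft {n : ℕ} {X Y : FGModuleCat.{u} A} (h : ExtVanishing A X Y n) :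
    ExtVanishing Aᵐᵒᵖ (dualLeft hj Y) (dualLeft hj X) n :=
  haveI := finite_op R A
  ExtVanishing.dual (A := A) (B := Aᵐᵒᵖ) hj AlgEquiv.refl (AlgEquiv.opOp R A) (fun _ => rfl) h

/-- Dualize the vanishing of Ext^k(Tr_d X, DN), using N ≅ D D N. -/
lemma extVanishing_tauObj {X N : FGModuleCat.{u} Aᵐᵒᵖ}
    (hA : ExtVanishing Aᵐᵒᵖ X A (d - 1)) (hN : ExtVanishing Aᵐᵒᵖ X N (d - 1)) :
    ExtVanishing Aᵐᵒᵖ N (tauObj R A hj d X) (d - 1) := by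
  have := finite_op R A
  have := isNoetherianRing_of_finite R Aᵐᵒᵖ
  have h := extVanishing_trObj (AlgEquiv.opOp R A) (opRegular A).symm hj (fun _ _ => rfl) hA hN
  exact ExtVanishing.congr_left (evalRight hj N).symm (h.dualLeft hj)

/-- The vanishing statement for transposes, applied to the left modules DX and DN; Ext^k(DX, DN)
vanishes by duality. -/
lemma extVanishing_tauInvObj {X N : FGModuleCat.{u} Aᵐᵒᵖ}
    (hA : ExtVanishing A (dualRight hj X) A (d - 1)) (hN : ExtVanishing Aᵐᵒᵖ N X (d - 1)) :
    ExtVanishing Aᵐᵒᵖ (tauInvObj R A hj d X) N (d - 1) := by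
  have := finite_op R A
  have := isNoetherianRing_of_finite R A
  have h := extVanishing_trObj (AlgEquiv.refl : Aᵐᵒᵖ ≃ₐ[R] Aᵐᵒᵖ) (LinearEquiv.refl A A) hj
    (fun _ _ => rfl) hA (hN.dualRight hj)
  exact ExtVanishing.congr_right (evalRight hj N).symm h

variable {d} {𝓜 : ObjectProperty (FGModuleCat.{u} Aᵐᵒᵖ)} (h𝓜 : IsClusterTilting d 𝓜)

include h𝓜

/-- The regular module is projective, so the left-hand criterion places it in 𝓜. -/
lemma IsClusterTilting.extVanishing_regular {X : FGModuleCat.{u} Aᵐᵒᵖ} (hX : 𝓜 X) :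
    ExtVanishing Aᵐᵒᵖ X A (d - 1) :=
  h𝓜.extVanishing (Y := FGModuleCat.of Aᵐᵒᵖ A) hX
    (h𝓜.mem_of_extVanishing_left fun _ _ => extVanishing_of_projective _)

/-- The module DΛ is injective, so it lies in 𝓜 and Ext^k(DΛ, X) = 0; dualize and use D D Λ ≅ Λ. -/
lemma IsClusterTilting.extVanishing_dual_regular {X : FGModuleCat.{u} Aᵐᵒᵖ} (hX : 𝓜 X) :
    ExtVanishing A (dualRight hj X) A (d - 1) := by
  let P := FGModuleCat.of A A
  have hP : Module.Projective A P := inferInstanceAs (Module.Projective A A)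
  have hI : Module.Injective Aᵐᵒᵖ (dualLeft hj P) := injective_dualObj hj AlgEquiv.refl P
  have h : 𝓜 (dualLeft hj P) :=
    h𝓜.mem_of_extVanishing_right fun _ _ => extVanishing_of_injective _
  exact ExtVanishing.congr_right (evalLeft hj P).symm ((h𝓜.extVanishing h hX).dualRight hj)

lemma IsClusterTilting.tauObj_mem {X : FGModuleCat.{u} Aᵐᵒᵖ} (hX : 𝓜 X) :
    𝓜 (tauObj R A hj d X) :=
  h𝓜.mem_of_extVanishing_right fun _ hN =>
    extVanishing_tauObj hj d (h𝓜.extVanishing_regular hX) (h𝓜.extVanishing hX hN)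

lemma IsClusterTilting.tauInvObj_mem {X : FGModuleCat.{u} Aᵐᵒᵖ} (hX : 𝓜 X) :
    𝓜 (tauInvObj R A hj d X) :=
  h𝓜.mem_of_extVanishing_left fun _ hN =>
    extVanishing_tauInvObj hj d (h𝓜.extVanishing_dual_regular hj hX) (h𝓜.extVanishing hN hX)

end TranslationVanishing

/-! ### The translations are mutually inverse on the stable categories of 𝓜 -/

section TranslationEquivalence

variable {R : Type u} [CommRing R] [IsArtinianRing R] {A : Type u} [Ring A] [Algebra R A]
  [Module.Finite R A] {E : Type u} [AddCommGroup E] [Module R E] {j : SimpleSum R →ₗ[R] E}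
  (hj : IsInjectiveEnvelope R j) (d : ℕ)

variable (R A) in
/-- The comparison `Tr_d Tr_d ⟶ 𝟭` on right modules. -/
def trRightCounit : trRight R A d ⋙ (trLeft R A d).leftOp ⟶ 𝟭 (PStable Aᵐᵒᵖ) :=
  haveI := finite_op R A
  haveI := isNoetherianRing_of_finite R A
  haveI := isNoetherianRing_of_finite R Aᵐᵒᵖ
  trPowCounit (B := A) (toModuleEnd_bijective_right R A) (d - 1)

variable (R A) in
/-- The comparison `Tr_d Tr_d ⟶ 𝟭` on left modules. -/
def trLeftCounit : trLeft R A d ⋙ (trRight R A d).leftOp ⟶ 𝟭 (PStable A) :=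
  haveI := finite_op R A
  haveI := isNoetherianRing_of_finite R A
  haveI := isNoetherianRing_of_finite R Aᵐᵒᵖ
  trPowCounit (B := Aᵐᵒᵖ) (toModuleEnd_bijective_left R A) (d - 1)

lemma isIso_trRightCounit (X : PStable Aᵐᵒᵖ) (h : ExtVanishing Aᵐᵒᵖ X.as A (d - 1)) :
    IsIso ((trRightCounit R A d).app X) :=
  haveI := finite_op R A
  haveI := isNoetherianRing_of_finite R A
  haveI := isNoetherianRing_of_finite R Aᵐᵒᵖ
  isIso_trPowCounit (B := A) (toModuleEnd_bijective_right R A) (d - 1) X.as h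

lemma isIso_trLeftCounit (X : PStable A) (h : ExtVanishing A X.as A (d - 1)) :
    IsIso ((trLeftCounit R A d).app X) :=
  haveI := finite_op R A
  haveI := isNoetherianRing_of_finite R A
  haveI := isNoetherianRing_of_finite R Aᵐᵒᵖ
  isIso_trPowCounit (B := Aᵐᵒᵖ) (toModuleEnd_bijective_left R A) (d - 1) X.as h

/-- The duality from right to left modules, on the injectively stable category. -/
def dualIPRight : IStable Aᵐᵒᵖ ⥤ (PStable A)ᵒᵖ :=
  haveI := finite_op R A
  dualIP (A := Aᵐᵒᵖ) (B := A) (AlgEquiv.opOp R A) hj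

/-- The duality from left to right modules, on the projectively stable category. -/
def dualPILeft : (PStable A)ᵒᵖ ⥤ IStable Aᵐᵒᵖ := dualPI (A := A) (B := Aᵐᵒᵖ) AlgEquiv.refl hj

/-- The isomorphism `D D ≅ 𝟭` on left modules. -/
def dualCounitLeft : dualPILeft hj ⋙ dualIPRight hj ≅ 𝟭 (PStable A)ᵒᵖ :=
  haveI := finite_op R A
  dualCounitP (A := A) (B := Aᵐᵒᵖ) hj AlgEquiv.refl (AlgEquiv.opOp R A) fun _ => rfl

/-- The isomorphism `𝟭 ≅ D D` on right modules. -/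
def dualUnitRight : 𝟭 (IStable Aᵐᵒᵖ) ≅ dualIPRight hj ⋙ dualPILeft hj :=
  haveI := finite_op R A
  dualUnitI (A := Aᵐᵒᵖ) (B := A) hj (AlgEquiv.opOp R A) AlgEquiv.refl fun _ => rfl

/-- The comparison `τ_d⁻ τ_d ⟶ 𝟭`. -/
def tauCounit : tau R A hj d ⋙ tauInv R A hj d ⟶ 𝟭 (PStable Aᵐᵒᵖ) where
  app X := (trLeft R A d).leftOp.map ((dualCounitLeft hj).hom.app ((trRight R A d).obj X)) ≫
    (trRightCounit R A d).app X
  naturality X Y f := by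
    have h1 := congrArg (trLeft R A d).leftOp.map
      ((dualCounitLeft hj).hom.naturality ((trRight R A d).map f))
    rw [Functor.map_comp, Functor.map_comp] at h1
    have h2 := (trRightCounit R A d).naturality f
    exact ((reassoc_of% h1) _).trans ((congrArg _ h2).trans (Category.assoc _ _ _).symm)

/-- The comparison `𝟭 ⟶ τ_d τ_d⁻`. -/
def tauUnit : 𝟭 (IStable Aᵐᵒᵖ) ⟶ tauInv R A hj d ⋙ tau R A hj d where
  app X := (dualUnitRight hj).hom.app X ≫
    (dualPILeft hj).map ((trLeftCounit R A d).app ((dualIPRight hj).obj X).unop).op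
  naturality X Y f := by
    have h1 := (dualUnitRight hj).hom.naturality f
    have h2 := congrArg (fun g => (dualPILeft hj).map (Quiver.Hom.op g))
      ((trLeftCounit R A d).naturality ((dualIPRight hj).map f).unop)
    rw [op_comp, op_comp, Functor.map_comp, Functor.map_comp] at h2
    refine ((reassoc_of% h1) _).trans (Eq.trans ?_ (Category.assoc _ _ _).symm)
    exact congrArg ((dualUnitRight hj).hom.app X ≫ ·) h2.symm

variable {d} {𝓜 : ObjectProperty (FGModuleCat.{u} Aᵐᵒᵖ)} (h𝓜 : IsClusterTilting d 𝓜)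

include h𝓜

lemma IsClusterTilting.isIso_tauCounit {X : PStable Aᵐᵒᵖ} (hX : pStableProp 𝓜 X) :
    IsIso ((tauCounit hj d).app X) := by
  have := isIso_trRightCounit (R := R) d X (h𝓜.extVanishing_regular hX)
  exact IsIso.comp_isIso' (inferInstanceAs (IsIso ((trLeft R A d).leftOp.map
    ((dualCounitLeft hj).hom.app ((trRight R A d).obj X))))) this

/-- The unit contains the comparison Tr_d Tr_d → 1 at the left module DX, so the vanishing needed is
that of Ext^k(DX, Λ). -/
lemma IsClusterTilting.isIso_tauUnit {X : IStable Aᵐᵒᵖ} (hX : iStableProp 𝓜 X) :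
    IsIso ((tauUnit hj d).app X) := by
  have := isIso_trLeftCounit (R := R) d ((dualIPRight hj).obj X).unop
    (h𝓜.extVanishing_dual_regular hj hX)
  exact IsIso.comp_isIso' (inferInstanceAs (IsIso ((dualUnitRight hj).hom.app X)))
    (inferInstanceAs (IsIso ((dualPILeft hj).map
      ((trLeftCounit R A d).app ((dualIPRight hj).obj X).unop).op)))

/-- The restrictions of `τ_d` and `τ_d⁻` to a `d`-cluster-tilting subcategory are mutually inverse
equivalences. -/
def IsClusterTilting.tauEquivalence (h : ∀ M, 𝓜 M → 𝓜 (tauObj R A hj d M))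
    (h' : ∀ M, 𝓜 M → 𝓜 (tauInvObj R A hj d M)) : PStableSub 𝓜 ≌ IStableSub 𝓜 :=
  -- `Equivalence.mk` may modify one of the given isomorphisms to obtain the triangle identities but
  -- keeps both functors, so they are the restricted translations definitionally.
  CategoryTheory.Equivalence.mk (tauSub R A hj d 𝓜 h) (tauInvSub R A hj d 𝓜 h')
    (NatIso.ofComponents
      (fun X =>
        haveI : IsIso ((tauCounit hj d).app X.obj) := h𝓜.isIso_tauCounit hj X.property
        (ObjectProperty.isoMk (X := (tauSub R A hj d 𝓜 h ⋙ tauInvSub R A hj d 𝓜 h').obj X)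
          (Y := X) _ (asIso ((tauCounit hj d).app X.obj) :)).symm)
      fun {X Y} f => by
        have := h𝓜.isIso_tauCounit hj X.property
        have := h𝓜.isIso_tauCounit hj Y.property
        refine ObjectProperty.hom_ext _ ?_
        have hn := (tauCounit hj d).naturality f.hom
        change f.hom ≫ inv ((tauCounit hj d).app Y.obj) =
          inv ((tauCounit hj d).app X.obj) ≫ (tau R A hj d ⋙ tauInv R A hj d).map f.hom
        rw [IsIso.comp_inv_eq, Category.assoc, IsIso.eq_inv_comp]
        exact hn.symm)
    (NatIso.ofComponents
      (fun X =>
        haveI : IsIso ((tauUnit hj d).app X.obj) := h𝓜.isIso_tauUnit hj X.property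
        (ObjectProperty.isoMk (X := X)
          (Y := (tauInvSub R A hj d 𝓜 h' ⋙ tauSub R A hj d 𝓜 h).obj X) _
          (asIso ((tauUnit hj d).app X.obj) :)).symm)
      fun {X Y} f => by
        have := h𝓜.isIso_tauUnit hj X.property
        have := h𝓜.isIso_tauUnit hj Y.property
        refine ObjectProperty.hom_ext _ ?_
        have hn := (tauUnit hj d).naturality f.hom
        change (tauInv R A hj d ⋙ tau R A hj d).map f.hom ≫ inv ((tauUnit hj d).app Y.obj) =
          inv ((tauUnit hj d).app X.obj) ≫ f.hom
        rw [IsIso.comp_inv_eq, Category.assoc, IsIso.eq_inv_comp]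
        exact hn.symm)

end TranslationEquivalence
end HigherAR

theorem mainTheorem5 {R : Type u} [CommRing R] [IsArtinianRing R]
    {Λ : Type u} [Ring Λ] [Algebra R Λ] [Module.Finite R Λ]
    {E : Type u} [AddCommGroup E] [Module R E]
    (j : HigherAR.SimpleSum R →ₗ[R] E) (hj : HigherAR.IsInjectiveEnvelope R j)
    (d : ℕ) (hd : 0 < d)
    (𝓜 : ObjectProperty (FGModuleCat.{u} Λᵐᵒᵖ)) (h𝓜 : HigherAR.IsClusterTilting d 𝓜) :
    (∃ (h : ∀ M, 𝓜 M → 𝓜 (HigherAR.tauObj R Λ hj d M))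
      (h' : ∀ M, 𝓜 M → 𝓜 (HigherAR.tauInvObj R Λ hj d M))
      (e : HigherAR.PStableSub 𝓜 ≌ HigherAR.IStableSub 𝓜),
      e.functor = HigherAR.tauSub R Λ hj d 𝓜 h ∧ e.inverse = HigherAR.tauInvSub R Λ hj d 𝓜 h') ∧
    ∀ M N, 𝓜 M → 𝓜 N → ∀ i, 1 ≤ i → i < d →
      Nonempty (HigherAR.ExtFG N (HigherAR.tauObj R Λ hj d M) (d - i) ≃ₗ[R]
        (HigherAR.ExtFG M N i →ₗ[R] E)) ∧
      Subsingleton (HigherAR.ExtFG N (HigherAR.tauObj R Λ hj d M) (d - i)) := by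
  have h M (hM : 𝓜 M) := h𝓜.tauObj_mem hj hM
  have h' M (hM : 𝓜 M) := h𝓜.tauInvObj_mem hj hM
  refine ⟨⟨h, h', h𝓜.tauEquivalence hj h h', rfl, rfl⟩, fun M N hM hN i h1 h2 => ?_⟩
  have hs : Subsingleton (HigherAR.ExtFG N (HigherAR.tauObj R Λ hj d M) (d - i)) :=
    -- From 1 ≤ i < d also 1 ≤ d - i < d, and τ_d M lies in 𝓜, so the defining vanishing applies on
    -- this side too; the isomorphism is then one between zero modules.
    (h𝓜.mem_iff_ext_left N).mp hN (d - i) (by omega) (by omega) _ (h M hM)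
  have hs' : Subsingleton (HigherAR.ExtFG M N i) :=
    (h𝓜.mem_iff_ext_left M).mp hM i h1 h2 N hN
  have hs'' : Subsingleton (HigherAR.ExtFG M N i →ₗ[R] E) :=
    ⟨fun f g => LinearMap.ext fun x => by rw [Subsingleton.elim x 0, map_zero, map_zero]⟩
  exact ⟨⟨LinearEquiv.ofSubsingleton _ _⟩, hs⟩

end
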